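/- Let $n\ge 3$. There exist a smooth one-parameter family $(g_t)_{t\in\mathbb{R}}$ of Riemannian metrics on the sphere $S^{2n+1}$ (smooth jointly in $t$ and the point), with $g_0$ the round metric induced from $\mathbb{R}^{2n+2}$, and a vector field $\xi$ on $S^{2n+1}$, such that for every $t\neq 0$: 1. $\xi$ is a K-contact structure on $(S^{2n+1},g_t)$, that is, $\xi$ is a Killing vector field of unit length and, with $\eta=g_t(\xi,\cdot)$, the endomorphism $\varphi$ defined by $g_t(\varphi X,Y)=\tfrac12\,d\eta(X,Y)$ satisfies $\varphi^2=-\mathrm{Id}+\eta\otimes\xi$, where $d\eta(X,Y)=X(\eta(Y))-Y(\eta(X))-\eta([X,Y])$; 2. $\xi$ is not a Sasakian structure on $(S^{2n+1},g_t)$, that is, the identity $(\nabla_X\nabla\xi)Y=g_t(\xi,Y)X-g_t(X,Y)\xi$ for all vector fields $X,Y$, with $\nabla$ the Levi-Civita connection of $g_t$, fails; 3. the component $\mathfrak{g}_2=\{A\in\mathfrak{g} : [\xi,[\xi,A]]=-4A\}$ of the Lie algebra $\mathfrak{g}$ of Killing vector fields of $g_t$ (the Lie algebra of the isometry group of $g_t$)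 contains a Killing field whose $g_t$-length is not constant. -/

import Mathlib

open Bundle VectorField
open scoped Manifold ContDiff

set_option linter.unusedSectionVars false

noncomputable section

namespace KContactGeometry

section General

variable {E : Type*} [NormedAddCommGroup E] [NormedSpace ℝ E]
  {H : Type*} [TopologicalSpace H] {I : ModelWithCorners ℝ E H}
  {M : Type*} [TopologicalSpace M] [ChartedSpace H M]

variable (I M) in
/-- (Not necessarily smooth) vector fields on `M`. -/
abbrev VField := (x : M) → TangentSpace I x

variable (I M) in
/-- Smooth Riemannian metrics on `M`. -/
abbrev RiemMetric [IsManifold I ∞ M] := ContMDiffRiemannianMetric I ∞ E (fun x : M => TangentSpace I x)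

variable [IsManifold I ∞ M]

/-- Smoothness of a vector field, as a section of the tangent bundle. -/
def SmoothField (X : VField I M) : Prop :=
  ContMDiff I I.tangent ∞ (fun x => (X x : TangentBundle I M))

/-- The function `g(X, Y)`. -/
def pairing (g : RiemMetric I M) (X Y : VField I M) (x : M) : ℝ := g.inner x (X x) (Y x)

/-- The function `X f`: the derivative of `f` in the direction of the vector field `X`. -/
def dirDeriv (X : VField I M) (f : M → ℝ) (x : M) : ℝ := mvfderiv I f x (X x)

/-! ### The Levi-Civita connection, through the Koszul formula -/

/-- The right-hand side of the Koszul formula for `2 g(∇_X Y, Z)`. -/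
def koszul (g : RiemMetric I M) (X Y Z : VField I M) (x : M) : ℝ :=
  dirDeriv X (pairing g Y Z) x + dirDeriv Y (pairing g X Z) x - dirDeriv Z (pairing g X Y) x
    + g.inner x (mlieBracket I X Y x) (Z x) - g.inner x (mlieBracket I X Z x) (Y x)
    - g.inner x (mlieBracket I Y Z x) (X x)

lemma mdifferentiableAt_pairing (g : RiemMetric I M) {X Y : VField I M} {x : M}
    (hX : MDiffAt (T% X) x) (hY : MDiffAt (T% Y) x) : MDiffAt (pairing g X Y) x := by
  have : MDifferentiableAt I (I.prod 𝓘(ℝ))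
      (fun m ↦ TotalSpace.mk' ℝ (E := Bundle.Trivial M ℝ) m (g.inner m (X m) (Y m))) x := by
    apply MDifferentiableAt.clm_bundle_apply₂ (F₁ := E) (F₂ := E)
    · exact g.contMDiff.mdifferentiableAt (by simp)
    · exact hX
    · exact hY
  simp only [mdifferentiableAt_totalSpace] at this
  exact this.2

lemma pairing_smul_left (g : RiemMetric I M) (f : M → ℝ) (X Y : VField I M) :
    pairing g (f • X) Y = f * pairing g X Y := by
  ext x; simp [pairing]

lemma pairing_smul_right (g : RiemMetric I M) (f : M → ℝ) (X Y : VField I M) :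
    pairing g X (f • Y) = f * pairing g X Y := by
  ext x; simp [pairing]

lemma pairing_add_left (g : RiemMetric I M) (X X' Y : VField I M) :
    pairing g (X + X') Y = pairing g X Y + pairing g X' Y := by
  ext x; simp [pairing]

lemma pairing_add_right (g : RiemMetric I M) (X Y Y' : VField I M) :
    pairing g X (Y + Y') = pairing g X Y + pairing g X Y' := by
  ext x; simp [pairing]

lemma dirDeriv_smul_field (f : M → ℝ) (X : VField I M) (h : M → ℝ) (x : M) :
    dirDeriv (f • X) h x = f x * dirDeriv X h x := by
  simp [dirDeriv]

lemma dirDeriv_add_field (X X' : VField I M) (h : M → ℝ) (x : M) :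
    dirDeriv (X + X') h x = dirDeriv X h x + dirDeriv X' h x := by
  simp [dirDeriv]

lemma dirDeriv_mul {X : VField I M} {f h : M → ℝ} {x : M} (hf : MDiffAt f x) (hh : MDiffAt h x) :
    dirDeriv X (f * h) x = f x * dirDeriv X h x + h x * dirDeriv X f x := by
  simp [dirDeriv, mvfderiv_mul hf hh]

lemma dirDeriv_add {X : VField I M} {f h : M → ℝ} {x : M} (hf : MDiffAt f x) (hh : MDiffAt h x) :
    dirDeriv X (f + h) x = dirDeriv X f x + dirDeriv X h x := by
  simp [dirDeriv, mvfderiv_add hf hh]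

variable [FiniteDimensional ℝ E]

lemma koszul_tensorial_left (g : RiemMetric I M) {Y Z : VField I M} {x : M}
    (hY : MDiffAt (T% Y) x) (hZ : MDiffAt (T% Z) x) :
    TensorialAt I E (fun X : VField I M => koszul g X Y Z x) x where
  smul {f X} hf hX := by
    have hXZ := mdifferentiableAt_pairing g hX hZ
    have hXY := mdifferentiableAt_pairing g hX hY
    simp only [koszul, pairing_smul_left, dirDeriv_smul_field, dirDeriv_mul hf hXZ,
      dirDeriv_mul hf hXY, mlieBracket_smul_left hf hX]
    simp [pairing, dirDeriv]
    ring
  add {X X'} hX hX' := by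
    simp only [koszul, pairing_add_left, dirDeriv_add_field,
      dirDeriv_add (mdifferentiableAt_pairing g hX hZ) (mdifferentiableAt_pairing g hX' hZ),
      dirDeriv_add (mdifferentiableAt_pairing g hX hY) (mdifferentiableAt_pairing g hX' hY),
      mlieBracket_add_left hX hX']
    simp
    ring

lemma koszul_tensorial_right (g : RiemMetric I M) {X Y : VField I M} {x : M}
    (hX : MDiffAt (T% X) x) (hY : MDiffAt (T% Y) x) :
    TensorialAt I E (fun Z : VField I M => koszul g X Y Z x) x where
  smul {f Z} hf hZ := by
    have hXZ := mdifferentiableAt_pairing g hX hZ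
    have hYZ := mdifferentiableAt_pairing g hY hZ
    simp only [koszul, pairing_smul_right, dirDeriv_smul_field, dirDeriv_mul hf hXZ,
      dirDeriv_mul hf hYZ, mlieBracket_smul_right hf hZ]
    simp [pairing, dirDeriv, g.symm x (Z x)]
    ring
  add {Z Z'} hZ hZ' := by
    simp only [koszul, pairing_add_right, dirDeriv_add_field,
      dirDeriv_add (mdifferentiableAt_pairing g hX hZ) (mdifferentiableAt_pairing g hX hZ'),
      dirDeriv_add (mdifferentiableAt_pairing g hY hZ) (mdifferentiableAt_pairing g hY hZ'),
      mlieBracket_add_right hZ hZ']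
    simp
    ring

lemma flat_injective (g : RiemMetric I M) (x : M) :
    Function.Injective (g.inner x : TangentSpace I x →ₗ[ℝ] TangentSpace I x →L[ℝ] ℝ) := by
  rw [← LinearMap.ker_eq_bot, LinearMap.ker_eq_bot']
  intro v hv
  by_contra hne
  have h1 := g.pos x v hne
  have h2 : g.inner x v v = 0 := congrArg (fun f : TangentSpace I x →L[ℝ] ℝ => f v) hv
  linarith

instance (x : M) : FiniteDimensional ℝ (TangentSpace I x) :=
  inferInstanceAs (FiniteDimensional ℝ E)

/-- The musical isomorphism `v ↦ g(v, ·)`. -/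
def flat (g : RiemMetric I M) (x : M) : TangentSpace I x ≃ₗ[ℝ] (TangentSpace I x →L[ℝ] ℝ) :=
  LinearEquiv.ofInjectiveOfFinrankEq
    (g.inner x : TangentSpace I x →ₗ[ℝ] TangentSpace I x →L[ℝ] ℝ) (flat_injective g x) (by
      have : T2Space (TangentSpace I x) := inferInstanceAs (T2Space E)
      rw [← (LinearMap.toContinuousLinearMap (𝕜 := ℝ) (E := TangentSpace I x) (F' := ℝ)).finrank_eq]
      exact (Subspace.dual_finrank_eq (K := ℝ) (V := TangentSpace I x)).symm)

lemma flat_apply (g : RiemMetric I M) (x : M) (v w : TangentSpace I x) :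
    flat g x v w = g.inner x v w := rfl

lemma inner_flat_symm (g : RiemMetric I M) (x : M) (a : TangentSpace I x →L[ℝ] ℝ)
    (w : TangentSpace I x) : g.inner x ((flat g x).symm a) w = a w := by
  rw [← flat_apply, LinearEquiv.apply_symm_apply]

/-- The bilinear form `(X, Z) ↦ 2 g(∇_X Y, Z)` on the tangent space at `x`. -/
def koszulForm (g : RiemMetric I M) (Y : VField I M) (x : M) (hY : MDiffAt (T% Y) x) :
    TangentSpace I x →L[ℝ] TangentSpace I x →L[ℝ] ℝ :=
  TensorialAt.mkHom₂ (I := I) (F := E) (F' := E) (V := fun x : M => TangentSpace I x)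
    (V' := fun x : M => TangentSpace I x) (fun X Z => koszul g X Y Z x) x
    (fun _ hZ => koszul_tensorial_left g hY hZ) (fun _ hX => koszul_tensorial_right g hX hY)

lemma koszulForm_apply (g : RiemMetric I M) {X Y Z : VField I M} {x : M}
    (hX : MDiffAt (T% X) x) (hY : MDiffAt (T% Y) x) (hZ : MDiffAt (T% Z) x) :
    koszulForm g Y x hY (X x) (Z x) = koszul g X Y Z x :=
  TensorialAt.mkHom₂_apply _ _ hX hZ

open Classical in
/-- `leviCivitaFun g Y x v` is `∇_v Y` at the point `x`, the vector determined by the Koszul formula.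
(Value `0` if `Y` is not differentiable at `x`.) -/
def leviCivitaFun (g : RiemMetric I M) (Y : VField I M) (x : M) :
    TangentSpace I x →L[ℝ] TangentSpace I x :=
  haveI : T2Space (TangentSpace I x) := inferInstanceAs (T2Space E)
  if hY : MDiffAt (T% Y) x then
    LinearMap.toContinuousLinearMap
      ((1 / 2 : ℝ) • ((flat g x).symm.toLinearMap ∘ₗ (koszulForm g Y x hY).toLinearMap))
  else 0

/-- The Koszul formula. -/
lemma two_mul_inner_leviCivitaFun (g : RiemMetric I M) {X Y Z : VField I M} {x : M}
    (hX : MDiffAt (T% X) x) (hY : MDiffAt (T% Y) x) (hZ : MDiffAt (T% Z) x) :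
    2 * g.inner x (leviCivitaFun g Y x (X x)) (Z x) = koszul g X Y Z x := by
  rw [← koszulForm_apply g hX hY hZ]
  simp [leviCivitaFun, hY, inner_flat_symm]

lemma ext_inner (g : RiemMetric I M) {x : M} {v w : TangentSpace I x}
    (h : ∀ Z : VField I M, MDiffAt (T% Z) x → g.inner x v (Z x) = g.inner x w (Z x)) : v = w := by
  apply flat_injective g x
  ext z
  have := h (FiberBundle.extend E z) (FiberBundle.mdifferentiableAt_extend ..)
  simpa using this

lemma ext_field {x : M} {f f' : TangentSpace I x →L[ℝ] TangentSpace I x}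
    (h : ∀ X : VField I M, MDiffAt (T% X) x → f (X x) = f' (X x)) : f = f' := by
  ext v
  have := h (FiberBundle.extend E v) (FiberBundle.mdifferentiableAt_extend ..)
  simpa using this

/-- The Levi-Civita connection of a smooth Riemannian metric. -/
def leviCivita (g : RiemMetric I M) : CovariantDerivative I E (fun x : M => TangentSpace I x) where
  toFun := leviCivitaFun g
  isCovariantDerivativeOnUniv :=
    { add := by
        intro Y Y' x hY hY' _
        refine ext_field fun X hX => ext_inner g fun Z hZ => ?_
        have h := two_mul_inner_leviCivitaFun g hX hY hZ
        have h' := two_mul_inner_leviCivitaFun g hX hY' hZ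
        have h'' := two_mul_inner_leviCivitaFun g hX (mdifferentiableAt_add_section hY hY') hZ
        have key : koszul g X (Y + Y') Z x = koszul g X Y Z x + koszul g X Y' Z x := by
          simp only [koszul, pairing_add_left, pairing_add_right, dirDeriv_add_field,
            dirDeriv_add (mdifferentiableAt_pairing g hY hZ) (mdifferentiableAt_pairing g hY' hZ),
            dirDeriv_add (mdifferentiableAt_pairing g hX hY) (mdifferentiableAt_pairing g hX hY'),
            mlieBracket_add_left hY hY', mlieBracket_add_right hY hY']
          simp
          ring
        simp only [_root_.add_apply, map_add]
        change 2 * g.inner x (leviCivitaFun g (Y + Y') x (X x)) (Z x) = _ at h''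
        linarith
      leibniz := by
        intro Y f x hY hf _
        refine ext_field fun X hX => ext_inner g fun Z hZ => ?_
        have h := two_mul_inner_leviCivitaFun g hX hY hZ
        have h'' := two_mul_inner_leviCivitaFun g hX (hf.smul_section hY) hZ
        have key : koszul g X (f • Y) Z x =
            f x * koszul g X Y Z x + 2 * (dirDeriv X f x * pairing g Y Z x) := by
          simp only [koszul, pairing_smul_left, pairing_smul_right, dirDeriv_smul_field,
            dirDeriv_mul hf (mdifferentiableAt_pairing g hY hZ),
            dirDeriv_mul hf (mdifferentiableAt_pairing g hX hY),
            mlieBracket_smul_left hf hY, mlieBracket_smul_right hf hY]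
          simp [pairing, dirDeriv, g.symm x (Y x)]
          ring
        change 2 * g.inner x (leviCivitaFun g (f • Y) x (X x)) (Z x) =
          koszul g X (f • Y) Z x at h''
        simp [pairing, dirDeriv] at key ⊢
        rw [key] at h''
        linear_combination (1 / 2) * h'' - (f x / 2) * h }

/-- The Levi-Civita connection is torsion-free. -/
lemma leviCivita_torsion (g : RiemMetric I M) : (leviCivita g).torsion = 0 := by
  rw [CovariantDerivative.torsion_eq_zero_iff]
  intro X Y x hX hY
  refine ext_inner g fun Z hZ => ?_
  have h := two_mul_inner_leviCivitaFun g hX hY hZ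
  have h' := two_mul_inner_leviCivitaFun g hY hX hZ
  have e : pairing g X Y = pairing g Y X := by ext y; exact g.symm y _ _
  simp only [koszul, mlieBracket_swap_apply (V := Y) (W := X), e] at h h'
  change g.inner x (leviCivitaFun g Y x (X x) - leviCivitaFun g X x (Y x)) (Z x) = _
  simp at h h' ⊢
  linarith

/-- The Levi-Civita connection is metric. -/
lemma leviCivita_metric (g : RiemMetric I M) {X Y Z : VField I M} {x : M}
    (hX : MDiffAt (T% X) x) (hY : MDiffAt (T% Y) x) (hZ : MDiffAt (T% Z) x) :
    dirDeriv X (pairing g Y Z) x =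
      g.inner x (leviCivita g Y x (X x)) (Z x) + g.inner x (Y x) (leviCivita g Z x (X x)) := by
  have h := two_mul_inner_leviCivitaFun g hX hY hZ
  have h' := two_mul_inner_leviCivitaFun g hX hZ hY
  have e : pairing g Y Z = pairing g Z Y := by ext y; exact g.symm y _ _
  rw [g.symm x (Y x)]
  change _ = g.inner x (leviCivitaFun g Y x (X x)) (Z x) +
    g.inner x (leviCivitaFun g Z x (X x)) (Y x)
  simp only [koszul, mlieBracket_swap_apply (V := Z) (W := Y), e] at h h' ⊢
  simp at h h'
  linarith

/-! ### Killing fields, contact metric, K-contact and Sasakian structures -/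

/-- `A` is a Killing field of `g`: it is smooth and `(L_A g)(X, Y) = 0` for all smooth `X`, `Y`. -/
def IsKilling (g : RiemMetric I M) (A : VField I M) : Prop :=
  SmoothField A ∧ ∀ X Y : VField I M, SmoothField X → SmoothField Y → ∀ x : M,
    dirDeriv A (pairing g X Y) x =
      g.inner x (mlieBracket I A X x) (Y x) + g.inner x (X x) (mlieBracket I A Y x)

/-- `ξ` has constant length `1`. -/
def IsUnitField (g : RiemMetric I M) (ξ : VField I M) : Prop := ∀ x, g.inner x (ξ x) (ξ x) = 1

/-- The exterior derivative `dη(X, Y) = X η(Y) - Y η(X) - η([X, Y])` of the 1-form `η = g(ξ, ·)`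
dual to `ξ`, evaluated on smooth vector fields. -/
def dDual (g : RiemMetric I M) (ξ X Y : VField I M) (x : M) : ℝ :=
  dirDeriv X (pairing g ξ Y) x - dirDeriv Y (pairing g ξ X) x
    - g.inner x (ξ x) (mlieBracket I X Y x)

/-- `ξ` is a contact metric structure on `(M, g)`: a (smooth) unit vector field such that the
endomorphism field `φ` with `g(φ X, Y) = ½ dη(X, Y)` satisfies `φ² = -1 + η ⊗ ξ`. -/
def IsContactMetric (g : RiemMetric I M) (ξ : VField I M) : Prop :=
  SmoothField ξ ∧ IsUnitField g ξ ∧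
    ∃ φ : (x : M) → TangentSpace I x →L[ℝ] TangentSpace I x,
      (∀ X Y : VField I M, SmoothField X → SmoothField Y → ∀ x : M,
        g.inner x (φ x (X x)) (Y x) = (1 / 2) * dDual g ξ X Y x) ∧
      ∀ (x : M) (v : TangentSpace I x), φ x (φ x v) = -v + g.inner x (ξ x) v • ξ x

/-- `ξ` is a K-contact structure on `(M, g)`: a contact metric structure with `ξ` Killing. -/
def IsKContact (g : RiemMetric I M) (ξ : VField I M) : Prop :=
  IsContactMetric g ξ ∧ IsKilling g ξ

/-- `ξ` is a Sasakian structure on `(M, g)`: a unit Killing field with `(∇_X ∇ξ) Y = (ξ ∧ X) Y`,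
that is `∇_X (∇_Y ξ) - ∇_{∇_X Y} ξ = g(ξ, Y) X - g(X, Y) ξ`, for all smooth `X`, `Y`. -/
def IsSasakian (g : RiemMetric I M) (ξ : VField I M) : Prop :=
  IsKilling g ξ ∧ IsUnitField g ξ ∧
    ∀ X Y : VField I M, SmoothField X → SmoothField Y → ∀ x : M,
      leviCivita g (fun y => leviCivita g ξ y (Y y)) x (X x)
          - leviCivita g ξ x (leviCivita g Y x (X x)) =
        g.inner x (ξ x) (Y x) • X x - g.inner x (X x) (Y x) • ξ x

/-- The component `𝔤_l` (`l > 0`) of the Lie algebra `𝔤` of Killing fields of `g` with respect to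
the Killing field `ξ`: the Killing fields `A` with `L_ξ (L_ξ A) = -l² A`. -/
def killingComponent (g : RiemMetric I M) (ξ : VField I M) (l : ℝ) : Set (VField I M) :=
  {A | IsKilling g A ∧ ∀ x, mlieBracket I ξ (mlieBracket I ξ A) x = -(l ^ 2) • A x}

/-- The length of the vector field `A` is constant. -/
def HasConstantLength (g : RiemMetric I M) (A : VField I M) : Prop :=
  ∃ c : ℝ, ∀ x, Real.sqrt (g.inner x (A x) (A x)) = c

/-- A one-parameter family of metrics `g t` which is smooth in `(t, x)`. -/
def IsSmoothFamily (g : ℝ → RiemMetric I M) : Prop :=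
  ContMDiff (𝓘(ℝ, ℝ).prod I) (I.prod 𝓘(ℝ, E →L[ℝ] E →L[ℝ] ℝ)) ∞
    (fun p : ℝ × M => TotalSpace.mk' (E →L[ℝ] E →L[ℝ] ℝ)
      (E := fun x : M => TangentSpace I x →L[ℝ] TangentSpace I x →L[ℝ] ℝ) p.2 ((g p.1).inner p.2))

end General

/-- The unit sphere `S^d` in `ℝ^{d+1}`. -/
abbrev Sphere (d : ℕ) := Metric.sphere (0 : EuclideanSpace ℝ (Fin (d + 1))) 1

/-- `g` is the round metric of `S^d`: the metric induced by the inclusion `S^d → ℝ^{d+1}`. -/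
def IsRound {d : ℕ} (g : RiemMetric (𝓡 d) (Sphere d)) : Prop :=
  ∀ (x : Sphere d) (v w : TangentSpace (𝓡 d) x),
    g.inner x v w =
      inner ℝ (mvfderiv (𝓡 d) (fun y : Sphere d => (y : EuclideanSpace ℝ (Fin (d + 1)))) x v)
        (mvfderiv (𝓡 d) (fun y : Sphere d => (y : EuclideanSpace ℝ (Fin (d + 1)))) x w)

/-- A deformation of the round metric of `S^d`: a smooth family `g t` of metrics (`t ∈ ℝ`) such
that `g 0` is the round metric. -/
def IsRoundDeformation {d : ℕ} (g : ℝ → RiemMetric (𝓡 d) (Sphere d)) : Prop :=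
  IsSmoothFamily g ∧ IsRound (g 0)

end KContactGeometry
end

open KContactGeometry

/-!
The round sphere `S²ⁿ⁺¹ ⊆ ℂⁿ⁺¹` with the Hopf field `ξ = J x` is Sasakian. A metric with the same
contact form `η` and the same Reeb field `ξ` is still K-contact if it is invariant under the Hopf
flow and if the endomorphism `φ` of the contact planes determined by `dη` still squares to `-1`.
The deformation keeps these properties: it stretches the horizontal vector field `m` and shrinks
`J m` such that the area form of the complex line spanned by `m` is unchanged:
`g_t = ⟨·,·⟩ + t² ⟨m, ·⟩² - t² / (1 + t² μ) ⟨J m, ·⟩²`, with `μ = |m|²`.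
Here `m = |z₃|² z₄ - |z₄|² z₃`, where `z₃` and `z₄` stand for the projections of the position
vector to two coordinate lines. This field is polynomial and invariant under the circle action,
so that `g_t` is smooth in `t` and in the point, and `ξ` is a Killing field of length one (`HermitianModel.form_invariant`,
`HermitianModel.isKContact_reeb`).

The skew map `A (z₁, z₂, z₃, …) = (-z̄₂, z̄₁, 0, …)` is antilinear, so that `[ξ, A] = -2 J A` and
`[ξ, [ξ, A]] = -4 A`. It kills `m` and preserves the deformed scalar products; the Killing field
defined by it has the same length as in the round metric, which vanishes where `z₁ = z₂ = 0` and
not elsewhere (`HermitianModel.A_mem_killingComponent`, `HermitianModel.not_hasConstantLength_A`).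

The Sasaki identity fails (`HermitianModel.not_isSasakian_reeb`). Let `s = |z₃|² + |z₄|²` and let
`R` be half the gradient of `s`, so that `∇_R ξ = J R`. For `X = m` and `Y = R`, paired with
`J m`, the Sasaki identity says that `g(∇_m (J R), J m) = ⟨∇_m R, m⟩`. By the Koszul formula the
left-hand side is `(1 - s) μ` for every `t`, and the right-hand side times `1 + t² μ` is
`g(∇_m R, m) = (1 - s) (μ + 4 t² μ²)`. So the identity would imply `3 t² μ² (1 - s) = 0`, which is
false at the points where `z₁`, `z₃` and `z₄` are nonzero.

Vector fields on the sphere are handled through the inclusion in the ambient space: the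
differential of the inclusion turns brackets into commutators of derivatives
(`mvfderiv_mlieBracket`), and it detects smoothness (`smoothField_of_contMDiff_mvfderiv`).
-/

noncomputable section

open Bundle VectorField Set Function
open scoped Manifold ContDiff Topology InnerProductSpace

set_option linter.unusedSectionVars false

namespace KContactGeometry

/-! ### The bracket of vector fields and the differential of a map -/

section Immersion

lemma two_le_infty : (2 : ℕ∞ω) ≤ ∞ := ENat.LEInfty.out

lemma one_add_one_le_infty : (1 + 1 : ℕ∞ω) ≤ ∞ := by
  rw [one_add_one_eq_two]
  exact two_le_infty

variable {E : Type*} [NormedAddCommGroup E] [NormedSpace ℝ E] [CompleteSpace E]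
  {M : Type*} [TopologicalSpace M] [ChartedSpace E M] [IsManifold 𝓘(ℝ, E) ∞ M]
  {F : Type*} [NormedAddCommGroup F] [NormedSpace ℝ F]

/-- At the centre of a chart, the derivative of a vector-valued function is the derivative of its
expression in that chart. -/
lemma mvfderiv_eq_fderiv_chart {h : M → F} {x : M} (hh : MDifferentiableAt 𝓘(ℝ, E) 𝓘(ℝ, F) h x) :
    mvfderiv 𝓘(ℝ, E) h x =
      fderiv ℝ (h ∘ (extChartAt 𝓘(ℝ, E) x).symm) (extChartAt 𝓘(ℝ, E) x x) := by
  have h1 := hh.mvfderiv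
  rw [ModelWithCorners.range_eq_univ, fderivWithin_univ] at h1
  exact h1

lemma mdifferentiableAt_mvfderiv_apply {f : M → F} (hf : ContMDiff 𝓘(ℝ, E) 𝓘(ℝ, F) ∞ f)
    {X : (x : M) → TangentSpace 𝓘(ℝ, E) x} {x : M} (hX : MDiffAt (T% X) x) :
    MDifferentiableAt 𝓘(ℝ, E) 𝓘(ℝ, F) (fun y => mvfderiv 𝓘(ℝ, E) f y (X y)) x := by
  have h1 : ContMDiff 𝓘(ℝ, E).tangent 𝓘(ℝ, F).tangent 1 (tangentMap 𝓘(ℝ, E) 𝓘(ℝ, F) f) :=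
    hf.contMDiff_tangentMap (m := 1) (n := ∞) one_add_one_le_infty
  have h2 := (h1.mdifferentiable one_ne_zero _).comp x hX
  have h3 := ((contMDiff_snd_tangentBundle_modelSpace F 𝓘(ℝ, F)
    (n := 1)).mdifferentiable one_ne_zero _).comp x h2
  exact h3

/-- The bracket `[X, Y]` differentiates functions as the commutator of `X` and `Y`. -/
lemma mvfderiv_mlieBracket {f : M → F} (hf : ContMDiff 𝓘(ℝ, E) 𝓘(ℝ, F) ∞ f)
    {X Y : (x : M) → TangentSpace 𝓘(ℝ, E) x} {x : M}
    (hX : MDiffAt (T% X) x) (hY : MDiffAt (T% Y) x) :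
    mvfderiv 𝓘(ℝ, E) f x (mlieBracket 𝓘(ℝ, E) X Y x) =
      mvfderiv 𝓘(ℝ, E) (fun y => mvfderiv 𝓘(ℝ, E) f y (Y y)) x (X x)
        - mvfderiv 𝓘(ℝ, E) (fun y => mvfderiv 𝓘(ℝ, E) f y (X y)) x (Y x) := by
  have : IsManifold 𝓘(ℝ, E) 2 M := IsManifold.of_le (n := ∞) two_le_infty
  have : IsManifold 𝓘(ℝ, E) 1 M := IsManifold.of_le (n := ∞) (by exact_mod_cast le_top)
  set e := extChartAt 𝓘(ℝ, E) x with he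
  set X' : E → E := mpullbackWithin 𝓘(ℝ, E) 𝓘(ℝ, E) e.symm X univ with hX'
  set Y' : E → E := mpullbackWithin 𝓘(ℝ, E) 𝓘(ℝ, E) e.symm Y univ with hY'
  have hdiff : ∀ {Z : (x : M) → TangentSpace 𝓘(ℝ, E) x}, MDiffAt (T% Z) x →
      DifferentiableAt ℝ (mpullbackWithin 𝓘(ℝ, E) 𝓘(ℝ, E) e.symm Z univ : E → E) (e x) := by
    intro Z hZ
    have h := (mdifferentiableWithinAt_univ.2 hZ).differentiableWithinAt_mpullbackWithin_vectorField
    rw [ModelWithCorners.range_eq_univ, preimage_univ, inter_self] at h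
    exact differentiableWithinAt_univ.1 h
  have hval : ∀ Z : (x : M) → TangentSpace 𝓘(ℝ, E) x,
      (mpullbackWithin 𝓘(ℝ, E) 𝓘(ℝ, E) e.symm Z univ : E → E) (e x) = Z x := by
    intro Z
    have h1 := mfderivWithin_extChartAt_symm_inverse_apply (I := 𝓘(ℝ, E)) (Z x)
    rw [ModelWithCorners.range_eq_univ] at h1
    have h2 : e.symm (e x) = x := extChartAt_to_inv x
    simp only [mpullbackWithin_apply]
    rw [h2]
    exact h1
  have hchart : ∀ Z : (x : M) → TangentSpace 𝓘(ℝ, E) x,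
      (fun y => mvfderiv 𝓘(ℝ, E) f y (Z y)) ∘ e.symm =ᶠ[𝓝 (e x)]
        fun p => fderiv ℝ (f ∘ e.symm) p
          ((mpullbackWithin 𝓘(ℝ, E) 𝓘(ℝ, E) e.symm Z univ : E → E) p) := by
    intro Z
    filter_upwards [extChartAt_target_mem_nhds (I := 𝓘(ℝ, E)) x] with p hp
    have hinv := isInvertible_mfderivWithin_extChartAt_symm (I := 𝓘(ℝ, E)) hp
    have hmd := mdifferentiableWithinAt_extChartAt_symm (I := 𝓘(ℝ, E)) hp
    rw [ModelWithCorners.range_eq_univ] at hinv hmd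
    have hmd' := mdifferentiableWithinAt_univ.1 hmd
    have hcomp := mfderiv_comp p (hf.mdifferentiableAt (by simp) : MDiffAt f (e.symm p)) hmd'
    have hfd : fderiv ℝ (f ∘ e.symm) p = mfderiv 𝓘(ℝ, E) 𝓘(ℝ, F) (f ∘ e.symm) p :=
      mfderiv_eq_fderiv.symm
    simp only [comp_apply, mpullbackWithin_apply]
    rw [hfd, hcomp]
    rw [mfderivWithin_univ] at hinv ⊢
    change _ = mfderiv 𝓘(ℝ, E) 𝓘(ℝ, F) f (e.symm p)
      (mfderiv 𝓘(ℝ, E) 𝓘(ℝ, E) e.symm p (((mfderiv 𝓘(ℝ, E) 𝓘(ℝ, E) e.symm p).inverse) _))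
    rw [hinv.self_apply_inverse]
    rfl
  have hsmooth : ContDiffAt ℝ 2 (f ∘ e.symm) (e x) := by
    have h1 : ContMDiffAt 𝓘(ℝ, E) 𝓘(ℝ, E) ∞ e.symm (e x) := by
      have := contMDiffWithinAt_extChartAt_symm_range (I := 𝓘(ℝ, E)) (n := ∞) x
        (mem_extChartAt_target x)
      rw [ModelWithCorners.range_eq_univ] at this
      exact this
    have h2 := ContMDiffAt.comp (e x) (hf _) h1
    exact h2.contDiffAt.of_le two_le_infty
  have hbr : mlieBracket 𝓘(ℝ, E) X Y x = lieBracket ℝ X' Y' (e x) := by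
    rw [← mlieBracketWithin_univ, mlieBracketWithin_apply]
    have h0 : (mfderiv 𝓘(ℝ, E) 𝓘(ℝ, E) (extChartAt 𝓘(ℝ, E) x) x) = ContinuousLinearMap.id ℝ _ :=
      mfderiv_extChartAt_self
    rw [h0]
    simp only [ModelWithCorners.range_eq_univ, preimage_univ, inter_self]
    rw [← lieBracketWithin_univ]
    change (ContinuousLinearMap.id ℝ E).inverse _ = _
    rw [ContinuousLinearMap.inverse_id]
    rfl
  rw [mvfderiv_eq_fderiv_chart (mdifferentiableAt_mvfderiv_apply hf hY),
    mvfderiv_eq_fderiv_chart (mdifferentiableAt_mvfderiv_apply hf hX),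
    mvfderiv_eq_fderiv_chart (hf.mdifferentiableAt (by simp)), hbr]
  have key := fderiv_apply_lieBracket (𝕜 := ℝ) hsmooth (by simp) (hdiff hY) (hdiff hX)
  rw [(hchart Y).fderiv_eq, (hchart X).fderiv_eq, ← hval X, ← hval Y]
  exact key

end Immersion

/-! ### Bilinear forms induced by a map -/

section Induced

variable {E : Type*} [NormedAddCommGroup E] [NormedSpace ℝ E] [FiniteDimensional ℝ E]
  {M : Type*} [TopologicalSpace M] [ChartedSpace E M] [IsManifold 𝓘(ℝ, E) ∞ M]
  {F : Type*} [NormedAddCommGroup F] [NormedSpace ℝ F]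
  {E' : Type*} [NormedAddCommGroup E'] [NormedSpace ℝ E'] {H' : Type*} [TopologicalSpace H']
  {J : ModelWithCorners ℝ E' H'} {N : Type*} [TopologicalSpace N] [ChartedSpace H' N]

/-- The derivative of `f` at `x`, read in the trivialization of the tangent bundle at `x₀`. -/
def coordDeriv (f : M → F) (x₀ x : M) : E →L[ℝ] F :=
  mvfderiv 𝓘(ℝ, E) f x ∘L (trivializationAt E (TangentSpace 𝓘(ℝ, E)) x₀).symmL ℝ x

lemma contMDiffAt_coordDeriv {f : M → F} (hf : ContMDiff 𝓘(ℝ, E) 𝓘(ℝ, F) ∞ f) (x₀ : M) :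
    ContMDiffAt 𝓘(ℝ, E) 𝓘(ℝ, E →L[ℝ] F) ∞ (coordDeriv (E := E) f x₀) x₀ := by
  have : IsManifold 𝓘(ℝ, E) 1 M := IsManifold.of_le (n := ∞) ENat.LEInfty.out
  have h := (hf x₀).mfderiv_const (m := ∞) (by simp)
  refine h.congr_of_eventuallyEq (Filter.Eventually.of_forall fun x => ?_)
  simp only [inTangentCoordinates, ContinuousLinearMap.inCoordinates, coordDeriv]
  rw [TangentBundle.continuousLinearMapAt_model_space]
  rfl

/-- The bilinear form on the tangent space at `x` induced from `B` by the map `f`. -/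
def inducedForm (f : M → F) (B : F →L[ℝ] F →L[ℝ] ℝ) (x : M) :
    TangentSpace 𝓘(ℝ, E) x →L[ℝ] TangentSpace 𝓘(ℝ, E) x →L[ℝ] ℝ :=
  (ContinuousLinearMap.precomp ℝ (mvfderiv 𝓘(ℝ, E) f x)) ∘L B ∘L (mvfderiv 𝓘(ℝ, E) f x)

lemma inducedForm_apply (f : M → F) (B : F →L[ℝ] F →L[ℝ] ℝ) (x : M)
    (v w : TangentSpace 𝓘(ℝ, E) x) :
    inducedForm f B x v w = B (mvfderiv 𝓘(ℝ, E) f x v) (mvfderiv 𝓘(ℝ, E) f x w) := rfl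

lemma contMDiff_inducedForm {f : M → F} (hf : ContMDiff 𝓘(ℝ, E) 𝓘(ℝ, F) ∞ f) {b : N → M}
    (hb : ContMDiff J 𝓘(ℝ, E) ∞ b) {G : N → F →L[ℝ] F →L[ℝ] ℝ}
    (hG : ContMDiff J 𝓘(ℝ, F →L[ℝ] F →L[ℝ] ℝ) ∞ G) :
    ContMDiff J (𝓘(ℝ, E).prod 𝓘(ℝ, E →L[ℝ] E →L[ℝ] ℝ)) ∞
      (fun p => TotalSpace.mk' (E →L[ℝ] E →L[ℝ] ℝ)
        (E := fun x : M => TangentSpace 𝓘(ℝ, E) x →L[ℝ] TangentSpace 𝓘(ℝ, E) x →L[ℝ] ℝ)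
        (b p) (inducedForm f (G p) (b p))) := by
  intro p₀
  rw [contMDiffAt_hom_bundle]
  refine ⟨hb p₀, ?_⟩
  have hD : ContMDiffAt J 𝓘(ℝ, E →L[ℝ] F) ∞ (fun p => coordDeriv (E := E) f (b p₀) (b p)) p₀ :=
    (contMDiffAt_coordDeriv hf (b p₀)).comp p₀ (hb p₀)
  have h1 : ContMDiffAt J 𝓘(ℝ, E →L[ℝ] E →L[ℝ] ℝ) ∞ (fun p =>
      ((ContinuousLinearMap.compL ℝ E F ℝ).flip (coordDeriv (E := E) f (b p₀) (b p))) ∘L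
        (G p ∘L coordDeriv (E := E) f (b p₀) (b p))) p₀ := by
    refine ContMDiffAt.clm_comp ?_ ((hG p₀).clm_comp hD)
    exact (ContinuousLinearMap.contDiff _).contMDiff.contMDiffAt.comp p₀ hD
  refine h1.congr_of_eventuallyEq ?_
  have hbase : ∀ᶠ p in 𝓝 p₀,
      b p ∈ (trivializationAt E (TangentSpace 𝓘(ℝ, E)) (b p₀)).baseSet :=
    (hb p₀).continuousAt.preimage_mem_nhds
      ((trivializationAt E (TangentSpace 𝓘(ℝ, E)) (b p₀)).open_baseSet.mem_nhds
        (FiberBundle.mem_baseSet_trivializationAt' (b p₀)))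
  filter_upwards [hbase] with p hp
  ext v w
  have key := inCoordinates_apply_eq₂ (𝕜 := ℝ) (F₁ := E) (F₂ := E) (F₃ := ℝ)
    (E₁ := (TangentSpace 𝓘(ℝ, E) : M → Type _)) (E₂ := (TangentSpace 𝓘(ℝ, E) : M → Type _))
    (E₃ := Bundle.Trivial M ℝ) (x₀ := b p₀) (x := b p) (ϕ := inducedForm f (G p) (b p))
    (v := v) (w := w) hp hp (mem_univ _)
  refine key.trans ?_
  simp only [inducedForm_apply, coordDeriv, ← Trivialization.symmL_apply (R := ℝ) _ hp]
  simp

lemma contMDiff_inducedForm_family {f : M → F} (hf : ContMDiff 𝓘(ℝ, E) 𝓘(ℝ, F) ∞ f)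
    {G : ℝ × F → F →L[ℝ] F →L[ℝ] ℝ} (hG : ContDiff ℝ ∞ G) :
    ContMDiff (𝓘(ℝ, ℝ).prod 𝓘(ℝ, E)) (𝓘(ℝ, E).prod 𝓘(ℝ, E →L[ℝ] E →L[ℝ] ℝ)) ∞
      (fun p : ℝ × M => TotalSpace.mk' (E →L[ℝ] E →L[ℝ] ℝ)
        (E := fun x : M => TangentSpace 𝓘(ℝ, E) x →L[ℝ] TangentSpace 𝓘(ℝ, E) x →L[ℝ] ℝ)
        p.2 (inducedForm f (G (p.1, f p.2)) p.2)) := by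
  refine contMDiff_inducedForm hf contMDiff_snd (hG.contMDiff.comp ?_)
  exact contMDiff_fst.prodMk_space (hf.comp contMDiff_snd)

end Induced

/-! ### Vector fields and metrics induced by an immersion -/

section Immersed

variable {E : Type*} [NormedAddCommGroup E] [InnerProductSpace ℝ E] [FiniteDimensional ℝ E]
  {M : Type*} [TopologicalSpace M] [ChartedSpace E M] [IsManifold 𝓘(ℝ, E) ∞ M]
  {F : Type*} [NormedAddCommGroup F] [InnerProductSpace ℝ F] [FiniteDimensional ℝ F]

lemma isUnit_adjoint_comp {D : E →L[ℝ] F} (hD : Injective D) :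
    IsUnit (ContinuousLinearMap.adjoint D ∘L D) := by
  have hinj : Injective (ContinuousLinearMap.adjoint D ∘L D) := by
    rw [injective_iff_map_eq_zero]
    intro a ha
    have h1 : ⟪D a, D a⟫_ℝ = 0 := by
      rw [← ContinuousLinearMap.adjoint_inner_right]
      change ⟪a, (ContinuousLinearMap.adjoint D ∘L D) a⟫_ℝ = 0
      rw [ha, inner_zero_right]
    exact (injective_iff_map_eq_zero D).1 hD a (inner_self_eq_zero.1 h1)
  rw [ContinuousLinearMap.isUnit_iff_bijective]
  exact ⟨hinj, (LinearMap.injective_iff_surjective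
    (f := (ContinuousLinearMap.adjoint D ∘L D : E →L[ℝ] E).toLinearMap)).1 hinj⟩

/-- An injective `D` has the left inverse `(D† D)⁻¹ D†`. -/
lemma inverse_adjoint_comp_apply {D : E →L[ℝ] F} (hD : Injective D) (v : E) :
    Ring.inverse (ContinuousLinearMap.adjoint D ∘L D)
      (ContinuousLinearMap.adjoint D (D v)) = v := by
  change (Ring.inverse (ContinuousLinearMap.adjoint D ∘L D) *
    (ContinuousLinearMap.adjoint D ∘L D)) v = v
  rw [Ring.inverse_mul_cancel _ (isUnit_adjoint_comp hD)]
  rfl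

/-- A vector field is smooth as soon as its image under an immersion into a Euclidean space is. -/
lemma smoothField_of_contMDiff_mvfderiv {f : M → F} (hf : ContMDiff 𝓘(ℝ, E) 𝓘(ℝ, F) ∞ f)
    (hinj : ∀ x, Injective (mvfderiv 𝓘(ℝ, E) f x)) {X : VField 𝓘(ℝ, E) M}
    (hX : ContMDiff 𝓘(ℝ, E) 𝓘(ℝ, F) ∞ (fun x => mvfderiv 𝓘(ℝ, E) f x (X x))) :
    SmoothField X := by
  intro x₀
  rw [contMDiffAt_section]
  set e := trivializationAt E (TangentSpace 𝓘(ℝ, E)) x₀ with he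
  have hD := contMDiffAt_coordDeriv hf x₀
  have hbase : ∀ᶠ x in 𝓝 x₀, x ∈ e.baseSet :=
    e.open_baseSet.mem_nhds (FiberBundle.mem_baseSet_trivializationAt' x₀)
  have hDinj : ∀ x ∈ e.baseSet, Injective (coordDeriv (E := E) f x₀ x) := by
    intro x hx
    refine (hinj x).comp ?_
    exact LeftInverse.injective (g := e.continuousLinearMapAt ℝ x)
      fun y => e.continuousLinearMapAt_symmL hx y
  -- the left inverse `(D† D)⁻¹ D†` of the derivative depends smoothly on the point
  have hadj : ContMDiffAt 𝓘(ℝ, E) 𝓘(ℝ, F →L[ℝ] E) ∞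
      (fun x => ContinuousLinearMap.adjoint (coordDeriv (E := E) f x₀ x)) x₀ :=
    ((ContinuousLinearMap.adjoint (𝕜 := ℝ) (E := E) (F := F)).toContinuousLinearEquiv
      |>.contDiff (n := ∞)).contMDiff.contMDiffAt.comp x₀ hD
  have hinv : ContMDiffAt 𝓘(ℝ, E) 𝓘(ℝ, E →L[ℝ] E) ∞ (fun x => Ring.inverse
      (ContinuousLinearMap.adjoint (coordDeriv (E := E) f x₀ x) ∘L coordDeriv (E := E) f x₀ x))
      x₀ := by
    obtain ⟨u, hu⟩ := isUnit_adjoint_comp (hDinj x₀ (FiberBundle.mem_baseSet_trivializationAt' x₀))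
    have h1 := contDiffAt_ringInverse ℝ (n := ∞) u
    rw [hu] at h1
    exact h1.contMDiffAt.comp x₀ (hadj.clm_comp hD)
  have h2 := hinv.clm_apply (hadj.clm_apply (hX x₀))
  refine h2.congr_of_eventuallyEq ?_
  filter_upwards [hbase] with x hx
  have h3 : mvfderiv 𝓘(ℝ, E) f x (X x) =
      coordDeriv (E := E) f x₀ x (e.continuousLinearMapAt ℝ x (X x)) := by
    change _ = mvfderiv 𝓘(ℝ, E) f x (e.symmL ℝ x (e.continuousLinearMapAt ℝ x (X x)))
    rw [e.symmL_continuousLinearMapAt hx]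
  rw [h3, inverse_adjoint_comp_apply (hDinj x hx)]
  exact (congrFun (e.coe_linearMapAt_of_mem (R := ℝ) hx) (X x)).symm

lemma isVonNBounded_inducedForm {f : M → F} {x : M} (hinj : Injective (mvfderiv 𝓘(ℝ, E) f x))
    {B : F →L[ℝ] F →L[ℝ] ℝ} {c : ℝ} (hc : 0 < c) (hB : ∀ w, c * ‖w‖ ^ 2 ≤ B w w) :
    Bornology.IsVonNBounded ℝ {v : TangentSpace 𝓘(ℝ, E) x | inducedForm f B x v v < 1} := by
  let D : E →L[ℝ] F := mvfderiv 𝓘(ℝ, E) f x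
  obtain ⟨K, hK, hKD⟩ := (D : E →ₗ[ℝ] F).exists_antilipschitzWith
    (LinearMap.ker_eq_bot.2 hinj)
  have hs : Bornology.IsBounded {v : E | B (D v) (D v) < 1} := by
    refine (Metric.isBounded_closedBall (x := (0 : E)) (r := K * (1 / c + 1))).subset fun v hv => ?_
    rw [mem_closedBall_zero_iff]
    have h1 : ‖v‖ ≤ K * ‖D v‖ := by simpa using hKD.le_mul_dist v 0
    have h2 : c * ‖D v‖ ^ 2 < 1 := (hB _).trans_lt hv
    have h3 : ‖D v‖ ^ 2 < 1 / c := by rw [lt_div_iff₀ hc]; linarith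
    refine h1.trans (mul_le_mul_of_nonneg_left ?_ K.2)
    nlinarith [sq_nonneg (‖D v‖ - 1), norm_nonneg (D v)]
  have hv : Bornology.IsVonNBounded ℝ {v : E | B (D v) (D v) < 1} :=
    (NormedSpace.isVonNBounded_iff ℝ).2 hs
  exact hv

/-- The Riemannian metric induced through an immersion `f` from a smooth family `G` of uniformly
positive symmetric forms on the target. -/
def inducedMetric {f : M → F} (hf : ContMDiff 𝓘(ℝ, E) 𝓘(ℝ, F) ∞ f)
    (hinj : ∀ x, Injective (mvfderiv 𝓘(ℝ, E) f x)) (G : M → F →L[ℝ] F →L[ℝ] ℝ)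
    (hG : ContMDiff 𝓘(ℝ, E) 𝓘(ℝ, F →L[ℝ] F →L[ℝ] ℝ) ∞ G) (hsymm : ∀ x v w, G x v w = G x w v)
    (hpos : ∀ x, ∃ c > 0, ∀ w, c * ‖w‖ ^ 2 ≤ G x w w) : RiemMetric 𝓘(ℝ, E) M where
  inner x := inducedForm f (G x) x
  symm x v w := hsymm x _ _
  pos x v hv := by
    obtain ⟨c, hc, h⟩ := hpos x
    refine lt_of_lt_of_le ?_ (h _)
    have : mvfderiv 𝓘(ℝ, E) f x v ≠ 0 :=
      fun h0 => hv ((injective_iff_map_eq_zero (mvfderiv 𝓘(ℝ, E) f x)).1 (hinj x) v h0)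
    positivity
  isVonNBounded x := by
    obtain ⟨c, hc, h⟩ := hpos x
    exact isVonNBounded_inducedForm (hinj x) hc h
  contMDiff := contMDiff_inducedForm hf contMDiff_id hG

end Immersed

/-! ### Vector fields and metrics on the sphere -/

section ProductRule

variable {E : Type*} [NormedAddCommGroup E] [NormedSpace ℝ E] [FiniteDimensional ℝ E]
  {M : Type*} [TopologicalSpace M] [ChartedSpace E M] [IsManifold 𝓘(ℝ, E) ∞ M]
  {F : Type*} [NormedAddCommGroup F] [NormedSpace ℝ F]

lemma mvfderiv_clm_apply₂ {B : M → F →L[ℝ] F →L[ℝ] ℝ} {u v : M → F} {x : M}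
    (hB : MDifferentiableAt 𝓘(ℝ, E) 𝓘(ℝ, F →L[ℝ] F →L[ℝ] ℝ) B x)
    (hu : MDifferentiableAt 𝓘(ℝ, E) 𝓘(ℝ, F) u x) (hv : MDifferentiableAt 𝓘(ℝ, E) 𝓘(ℝ, F) v x)
    (w : TangentSpace 𝓘(ℝ, E) x) :
    mvfderiv 𝓘(ℝ, E) (fun y => B y (u y) (v y)) x w =
      mvfderiv 𝓘(ℝ, E) B x w (u x) (v x) + B x (mvfderiv 𝓘(ℝ, E) u x w) (v x)
        + B x (u x) (mvfderiv 𝓘(ℝ, E) v x w) := by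
  have hd : ∀ {W : Type _} [NormedAddCommGroup W] [NormedSpace ℝ W] {h : M → W},
      MDifferentiableAt 𝓘(ℝ, E) 𝓘(ℝ, W) h x →
      DifferentiableAt ℝ (h ∘ (extChartAt 𝓘(ℝ, E) x).symm) (extChartAt 𝓘(ℝ, E) x x) := by
    intro W _ _ h hh
    have := (mdifferentiableWithinAt_univ.2 hh).differentiableWithinAt_comp_extChartAt_symm
    rw [ModelWithCorners.range_eq_univ, preimage_univ, inter_univ] at this
    exact differentiableWithinAt_univ.1 this
  have hBuv : MDifferentiableAt 𝓘(ℝ, E) 𝓘(ℝ, ℝ) (fun y => B y (u y) (v y)) x :=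
    (hB.clm_apply hu).clm_apply hv
  have h0 : (extChartAt 𝓘(ℝ, E) x).symm (extChartAt 𝓘(ℝ, E) x x) = x := extChartAt_to_inv x
  have hB' := (hd hB).hasFDerivAt
  have hu' := (hd hu).hasFDerivAt
  have hv' := (hd hv).hasFDerivAt
  rw [mvfderiv_eq_fderiv_chart hBuv, mvfderiv_eq_fderiv_chart hB, mvfderiv_eq_fderiv_chart hu,
    mvfderiv_eq_fderiv_chart hv]
  have key := ((hB'.clm_apply hu').clm_apply hv').fderiv
  have key' := congrArg (fun L : E →L[ℝ] ℝ => L w) key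
  simp only [comp_apply, h0] at key'
  refine Eq.trans key' ?_
  have hcomm : ∀ a b c : ℝ, a + (b + c) = c + b + a := fun a b c => by ring
  exact hcomm _ _ _

end ProductRule

section Sphere

variable {d : ℕ}

/-- The Euclidean space containing the sphere `S^d`. -/
abbrev Ambient (d : ℕ) := EuclideanSpace ℝ (Fin (d + 1))

/-- The inclusion of the sphere in the ambient Euclidean space. -/
def incl (d : ℕ) (y : Sphere d) : Ambient d := y

lemma inner_self_sphere (x : Sphere d) : ⟪(x : Ambient d), (x : Ambient d)⟫_ℝ = 1 := by
  rw [real_inner_self_eq_norm_sq, norm_eq_of_mem_sphere, one_pow]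

lemma contMDiff_incl : ContMDiff (𝓡 d) 𝓘(ℝ, Ambient d) ∞ (incl d) := by
  have := Fact.mk (@finrank_euclideanSpace_fin ℝ _ (d + 1))
  exact contMDiff_coe_sphere

/-- The differential of the inclusion of the sphere. -/
def dincl (x : Sphere d) : TangentSpace (𝓡 d) x →L[ℝ] Ambient d := mvfderiv (𝓡 d) (incl d) x

lemma dincl_injective (x : Sphere d) : Injective (dincl x) := by
  have := Fact.mk (@finrank_euclideanSpace_fin ℝ _ (d + 1))
  exact injective_mvfderiv_subtypeVal_sphere x

lemma dincl_range (x : Sphere d) : (dincl x).range = (ℝ ∙ (x : Ambient d))ᗮ := by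
  have := Fact.mk (@finrank_euclideanSpace_fin ℝ _ (d + 1))
  exact range_mvfderiv_subtypeVal x

lemma inner_dincl (x : Sphere d) (v : TangentSpace (𝓡 d) x) :
    ⟪(x : Ambient d), dincl x v⟫_ℝ = 0 := by
  have h : dincl x v ∈ (dincl x).range := ⟨v, rfl⟩
  rw [dincl_range] at h
  exact Submodule.mem_orthogonal_singleton_iff_inner_right.1 h

lemma exists_dincl_eq (x : Sphere d) (w : Ambient d) :
    ∃ v, dincl x v = w - ⟪(x : Ambient d), w⟫_ℝ • (x : Ambient d) := by
  have h : w - ⟪(x : Ambient d), w⟫_ℝ • (x : Ambient d) ∈ (dincl x).range := by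
    rw [dincl_range]
    refine Submodule.mem_orthogonal_singleton_iff_inner_right.2 ?_
    rw [inner_sub_right, inner_smul_right, inner_self_sphere, mul_one, sub_self]
  exact h

/-- The orthogonal projection of the ambient space to the tangent space of the sphere. -/
def tangentPart (x : Sphere d) (w : Ambient d) : TangentSpace (𝓡 d) x :=
  (exists_dincl_eq x w).choose

lemma dincl_tangentPart (x : Sphere d) (w : Ambient d) :
    dincl x (tangentPart x w) = w - ⟪(x : Ambient d), w⟫_ℝ • (x : Ambient d) :=
  (exists_dincl_eq x w).choose_spec

/-- The vector field on the sphere given by the tangential part of `F`. -/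
def sphereField (F : Ambient d → Ambient d) : VField (𝓡 d) (Sphere d) :=
  fun x => tangentPart x (F x)

/-- `F` is tangent to the sphere. -/
def IsTangent (F : Ambient d → Ambient d) : Prop :=
  ∀ x : Sphere d, ⟪(x : Ambient d), F x⟫_ℝ = 0

lemma dincl_sphereField {F : Ambient d → Ambient d} (hF : IsTangent F) (x : Sphere d) :
    dincl x (sphereField F x) = F x := by
  rw [sphereField, dincl_tangentPart, hF x, zero_smul, sub_zero]

lemma tangentPart_dincl (x : Sphere d) (v : TangentSpace (𝓡 d) x) :
    tangentPart x (dincl x v) = v := by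
  apply dincl_injective x
  rw [dincl_tangentPart, inner_dincl, zero_smul, sub_zero]

lemma sphereField_const (x : Sphere d) (v : TangentSpace (𝓡 d) x) :
    sphereField (fun _ => dincl x v) x = v := tangentPart_dincl x v

lemma smoothField_sphereField {F : Ambient d → Ambient d} (hF : ContDiff ℝ ∞ F) :
    SmoothField (sphereField F) := by
  refine smoothField_of_contMDiff_mvfderiv contMDiff_incl dincl_injective ?_
  have h1 : ContDiff ℝ ∞ (fun x : Ambient d => F x - ⟪x, F x⟫_ℝ • x) :=
    hF.sub ((contDiff_id.inner ℝ hF).smul contDiff_id)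
  have h2 := h1.contMDiff.comp (contMDiff_incl (d := d))
  refine h2.congr fun x => ?_
  exact dincl_tangentPart x (F x)

/-- Differentiability of a vector field of the sphere at a point. -/
abbrev DiffFieldAt (X : VField (𝓡 d) (Sphere d)) (x : Sphere d) : Prop :=
  MDifferentiableAt (𝓡 d) (𝓡 d).tangent (fun y => (X y : TangentBundle (𝓡 d) (Sphere d))) x

lemma SmoothField.mdiffAt {X : VField (𝓡 d) (Sphere d)} (hX : SmoothField X) (x : Sphere d) :
    DiffFieldAt X x := (hX x).mdifferentiableAt (by simp)

/-- A vector field on the sphere as a function with values in the ambient space. -/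
def ambientField (X : VField (𝓡 d) (Sphere d)) (x : Sphere d) : Ambient d := dincl x (X x)

lemma mdifferentiableAt_ambientField {X : VField (𝓡 d) (Sphere d)} {x : Sphere d}
    (hX : DiffFieldAt X x) :
    MDifferentiableAt (𝓡 d) 𝓘(ℝ, Ambient d) (ambientField X) x :=
  mdifferentiableAt_mvfderiv_apply contMDiff_incl hX

lemma mvfderiv_comp_incl {W : Type*} [NormedAddCommGroup W] [NormedSpace ℝ W] {Φ : Ambient d → W}
    {x : Sphere d} (hΦ : DifferentiableAt ℝ Φ x) (v : TangentSpace (𝓡 d) x) :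
    mvfderiv (𝓡 d) (fun y : Sphere d => Φ y) x v = fderiv ℝ Φ x (dincl x v) := by
  have h1 : MDifferentiableAt 𝓘(ℝ, Ambient d) 𝓘(ℝ, W) Φ (incl d x) := hΦ.mdifferentiableAt
  have h2 : MDifferentiableAt (𝓡 d) 𝓘(ℝ, Ambient d) (incl d) x :=
    contMDiff_incl.mdifferentiableAt (by simp)
  have h3 := mfderiv_comp_apply x h1 h2 v
  rw [mfderiv_eq_fderiv] at h3
  exact h3

/-- The bracket of two vector fields on the sphere, computed in the ambient space. -/
lemma dincl_mlieBracket {X Y : VField (𝓡 d) (Sphere d)} {x : Sphere d}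
    (hX : DiffFieldAt X x) (hY : DiffFieldAt Y x) :
    dincl x (mlieBracket (𝓡 d) X Y x) =
      mvfderiv (𝓡 d) (ambientField Y) x (X x) - mvfderiv (𝓡 d) (ambientField X) x (Y x) :=
  mvfderiv_mlieBracket contMDiff_incl hX hY

lemma ambientField_sphereField {F : Ambient d → Ambient d} (hF : IsTangent F) :
    ambientField (sphereField F) = fun x : Sphere d => F x :=
  funext fun x => dincl_sphereField hF x

lemma mvfderiv_ambientField_sphereField {F : Ambient d → Ambient d} (hF : IsTangent F)
    (hF' : ContDiff ℝ ∞ F) (x : Sphere d) (v : TangentSpace (𝓡 d) x) :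
    mvfderiv (𝓡 d) (ambientField (sphereField F)) x v = fderiv ℝ F x (dincl x v) := by
  rw [ambientField_sphereField hF]
  exact mvfderiv_comp_incl (hF'.differentiable (by simp) _) v

lemma dincl_mlieBracket_sphereField {F G : Ambient d → Ambient d} (hF : IsTangent F)
    (hF' : ContDiff ℝ ∞ F) (hG : IsTangent G) (hG' : ContDiff ℝ ∞ G) (x : Sphere d) :
    dincl x (mlieBracket (𝓡 d) (sphereField F) (sphereField G) x) =
      fderiv ℝ G x (F x) - fderiv ℝ F x (G x) := by
  rw [dincl_mlieBracket ((smoothField_sphereField hF').mdiffAt x)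
    ((smoothField_sphereField hG').mdiffAt x), mvfderiv_ambientField_sphereField hF hF',
    mvfderiv_ambientField_sphereField hG hG', dincl_sphereField hF, dincl_sphereField hG]

/-- The metric on the sphere whose value at `x` is the restriction of the bilinear form `G x`. -/
def sphereMetric (G : Ambient d → Ambient d →L[ℝ] Ambient d →L[ℝ] ℝ) (hG : ContDiff ℝ ∞ G)
    (hsymm : ∀ x v w, G x v w = G x w v) (hpos : ∀ x, ∃ c > 0, ∀ w, c * ‖w‖ ^ 2 ≤ G x w w) :
    RiemMetric (𝓡 d) (Sphere d) :=
  inducedMetric (contMDiff_incl (d := d)) dincl_injective (fun x => G x)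
    (hG.contMDiff.comp contMDiff_incl) (fun x => hsymm x) (fun x => hpos x)

section Metric

variable {G : Ambient d → Ambient d →L[ℝ] Ambient d →L[ℝ] ℝ} {hG : ContDiff ℝ ∞ G}
  {hsymm : ∀ x v w, G x v w = G x w v} {hpos : ∀ x, ∃ c > 0, ∀ w, c * ‖w‖ ^ 2 ≤ G x w w}

lemma sphereMetric_inner (x : Sphere d) (v w : TangentSpace (𝓡 d) x) :
    (sphereMetric G hG hsymm hpos).inner x v w = G x (dincl x v) (dincl x w) := rfl

set_option synthInstance.maxHeartbeats 200000 in
lemma dirDeriv_pairing_sphereMetric {X Y Z : VField (𝓡 d) (Sphere d)} {x : Sphere d}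
    (hY : DiffFieldAt Y x) (hZ : DiffFieldAt Z x) :
    dirDeriv X (pairing (sphereMetric G hG hsymm hpos) Y Z) x =
      fderiv ℝ G x (dincl x (X x)) (dincl x (Y x)) (dincl x (Z x))
        + G x (mvfderiv (𝓡 d) (ambientField Y) x (X x)) (dincl x (Z x))
        + G x (dincl x (Y x)) (mvfderiv (𝓡 d) (ambientField Z) x (X x)) := by
  have hGd : DifferentiableAt ℝ G x := hG.differentiable (by simp) _
  have h1 : MDifferentiableAt (𝓡 d) 𝓘(ℝ, Ambient d →L[ℝ] Ambient d →L[ℝ] ℝ)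
      (fun y : Sphere d => G y) x :=
    (hG.contMDiff.comp (contMDiff_incl (d := d))).mdifferentiableAt (by simp)
  have h2 := mvfderiv_clm_apply₂ h1 (mdifferentiableAt_ambientField hY)
    (mdifferentiableAt_ambientField hZ) (X x)
  have h3 := mvfderiv_comp_incl (W := Ambient d →L[ℝ] Ambient d →L[ℝ] ℝ) hGd (X x)
  rw [h3] at h2
  exact h2

/-- A tangent field `F` of the ambient space restricts to a Killing field as soon as the Lie
derivative of `G` along `F` vanishes on the sphere. -/
lemma isKilling_sphereField {F : Ambient d → Ambient d} (hF : IsTangent F)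
    (hF' : ContDiff ℝ ∞ F)
    (hinv : ∀ (x : Sphere d) (v w : Ambient d), fderiv ℝ G x (F x) v w + G x (fderiv ℝ F x v) w
      + G x v (fderiv ℝ F x w) = 0) :
    IsKilling (sphereMetric G hG hsymm hpos) (sphereField F) := by
  refine ⟨smoothField_sphereField hF', fun X Y hX hY x => ?_⟩
  have hA := (smoothField_sphereField hF').mdiffAt x
  rw [dirDeriv_pairing_sphereMetric (hX.mdiffAt x) (hY.mdiffAt x), sphereMetric_inner,
    sphereMetric_inner, dincl_mlieBracket hA (hX.mdiffAt x), dincl_mlieBracket hA (hY.mdiffAt x),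
    mvfderiv_ambientField_sphereField hF hF', mvfderiv_ambientField_sphereField hF hF',
    dincl_sphereField hF]
  have := hinv x (dincl x (X x)) (dincl x (Y x))
  simp only [map_sub, _root_.sub_apply]
  linarith

end Metric

end Sphere

section LeviCivita

variable {d : ℕ}

/-- The covariant derivative of a Killing field is half the exterior derivative of its dual. -/
lemma inner_leviCivita_killing {g : RiemMetric (𝓡 d) (Sphere d)} {ξ : VField (𝓡 d) (Sphere d)}
    (hξ : IsKilling g ξ) {Y Z : VField (𝓡 d) (Sphere d)} (hY : SmoothField Y) (hZ : SmoothField Z)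
    (x : Sphere d) :
    g.inner x (leviCivita g ξ x (Y x)) (Z x) = (1 / 2) * dDual g ξ Y Z x := by
  have h := two_mul_inner_leviCivitaFun g (hY.mdiffAt x) (hξ.1.mdiffAt x) (hZ.mdiffAt x)
  have hk := hξ.2 Y Z hY hZ x
  have e : pairing g Y ξ = pairing g ξ Y := by ext y; exact g.symm y _ _
  have hb : mlieBracket (𝓡 d) Y ξ x = - mlieBracket (𝓡 d) ξ Y x := mlieBracket_swap_apply
  simp only [koszul, e, hb] at h
  change 2 * g.inner x (leviCivita g ξ x (Y x)) (Z x) = _ at h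
  rw [dDual, g.symm x (ξ x)]
  have hs := g.symm x (Y x) (mlieBracket (𝓡 d) ξ Z x)
  simp only [map_neg, _root_.neg_apply] at h
  linarith

end LeviCivita

/-! ### The fields `m` and `R` in a Hermitian vector space -/

/-- A Hermitian structure `J` on a Euclidean space, a skew antilinear map `A`, and the orthogonal
projections `Q₁`, `Q₂` to two mutually orthogonal complex subspaces killed by `A`. -/
structure HermitianModel (V : Type*) [NormedAddCommGroup V] [InnerProductSpace ℝ V] where
  /-- the complex structure -/
  J : V →L[ℝ] V
  /-- the skew antilinear map -/
  A : V →L[ℝ] V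
  /-- the first projection -/
  Q₁ : V →L[ℝ] V
  /-- the second projection -/
  Q₂ : V →L[ℝ] V
  J_skew : ∀ x y, ⟪J x, y⟫_ℝ = -⟪x, J y⟫_ℝ
  J_J : ∀ x, J (J x) = -x
  A_skew : ∀ x y, ⟪A x, y⟫_ℝ = -⟪x, A y⟫_ℝ
  A_J : ∀ x, A (J x) = -J (A x)
  Q₁_symm : ∀ x y, ⟪Q₁ x, y⟫_ℝ = ⟪x, Q₁ y⟫_ℝ
  Q₂_symm : ∀ x y, ⟪Q₂ x, y⟫_ℝ = ⟪x, Q₂ y⟫_ℝ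
  Q₁_Q₁ : ∀ x, Q₁ (Q₁ x) = Q₁ x
  Q₂_Q₂ : ∀ x, Q₂ (Q₂ x) = Q₂ x
  Q₁_Q₂ : ∀ x, Q₁ (Q₂ x) = 0
  Q₂_Q₁ : ∀ x, Q₂ (Q₁ x) = 0
  Q₁_J : ∀ x, Q₁ (J x) = J (Q₁ x)
  Q₂_J : ∀ x, Q₂ (J x) = J (Q₂ x)
  Q₁_A : ∀ x, Q₁ (A x) = 0
  Q₂_A : ∀ x, Q₂ (A x) = 0
  A_Q₁ : ∀ x, A (Q₁ x) = 0
  A_Q₂ : ∀ x, A (Q₂ x) = 0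

namespace HermitianModel

variable {V : Type*} [NormedAddCommGroup V] [InnerProductSpace ℝ V] (S : HermitianModel V)

lemma inner_J_J (x y : V) : ⟪S.J x, S.J y⟫_ℝ = ⟪x, y⟫_ℝ := by
  rw [S.J_skew, S.J_J, inner_neg_right, neg_neg]

lemma inner_self_J (x : V) : ⟪x, S.J x⟫_ℝ = 0 := by
  have h := S.J_skew x x
  rw [real_inner_comm] at h
  linarith

lemma inner_self_A (x : V) : ⟪x, S.A x⟫_ℝ = 0 := by
  have h := S.A_skew x x
  rw [real_inner_comm] at h
  linarith

/-- The squared length of `Q₁ x`. -/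
def a (x : V) : ℝ := ⟪x, S.Q₁ x⟫_ℝ

/-- The squared length of `Q₂ x`. -/
def b (x : V) : ℝ := ⟪x, S.Q₂ x⟫_ℝ

lemma inner_Q₁_Q₁ (x : V) : ⟪S.Q₁ x, S.Q₁ x⟫_ℝ = S.a x := by
  rw [S.Q₁_symm, S.Q₁_Q₁, a]

lemma inner_Q₂_Q₂ (x : V) : ⟪S.Q₂ x, S.Q₂ x⟫_ℝ = S.b x := by
  rw [S.Q₂_symm, S.Q₂_Q₂, b]

lemma inner_Q₁_Q₂ (x y : V) : ⟪S.Q₁ x, S.Q₂ y⟫_ℝ = 0 := by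
  rw [S.Q₁_symm, S.Q₁_Q₂, inner_zero_right]

lemma inner_Q₂_Q₁ (x y : V) : ⟪S.Q₂ x, S.Q₁ y⟫_ℝ = 0 := by
  rw [S.Q₂_symm, S.Q₂_Q₁, inner_zero_right]

lemma inner_Q₁_J (x : V) : ⟪S.Q₁ x, S.J x⟫_ℝ = 0 := by
  rw [← S.Q₁_Q₁, S.Q₁_symm, S.Q₁_J, S.inner_self_J]

lemma inner_Q₂_J (x : V) : ⟪S.Q₂ x, S.J x⟫_ℝ = 0 := by
  rw [← S.Q₂_Q₂, S.Q₂_symm, S.Q₂_J, S.inner_self_J]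

/-- The horizontal vector field along which the metric is deformed. -/
def m (x : V) : V := S.a x • S.Q₂ x - S.b x • S.Q₁ x

/-- The squared length of `m`. -/
def μ (x : V) : ℝ := ⟪S.m x, S.m x⟫_ℝ

lemma μ_nonneg (x : V) : 0 ≤ S.μ x := real_inner_self_nonneg

lemma μ_eq (x : V) : S.μ x = S.a x * S.b x * (S.a x + S.b x) := by
  simp only [μ, m, inner_sub_left, inner_sub_right, inner_smul_left, inner_smul_right,
    inner_Q₁_Q₁, inner_Q₂_Q₂, inner_Q₁_Q₂, inner_Q₂_Q₁]
  simp
  ring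

lemma Q₁_m (x : V) : S.Q₁ (S.m x) = -(S.b x • S.Q₁ x) := by
  simp [m, S.Q₁_Q₁, S.Q₁_Q₂]

lemma Q₂_m (x : V) : S.Q₂ (S.m x) = S.a x • S.Q₂ x := by
  simp [m, S.Q₂_Q₂, S.Q₂_Q₁]

lemma A_m (x : V) : S.A (S.m x) = 0 := by
  simp [m, S.A_Q₁, S.A_Q₂]

lemma inner_self_m (x : V) : ⟪x, S.m x⟫_ℝ = 0 := by
  simp only [m, inner_sub_right, inner_smul_right, ← a.eq_1, ← b.eq_1]
  ring

lemma inner_J_m (x : V) : ⟪S.J x, S.m x⟫_ℝ = 0 := by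
  rw [real_inner_comm]
  simp only [m, inner_sub_left, inner_smul_left, inner_Q₁_J, inner_Q₂_J, mul_zero, sub_zero]

lemma inner_J_Jm (x : V) : ⟪S.J x, S.J (S.m x)⟫_ℝ = 0 := by
  rw [S.inner_J_J, S.inner_self_m]

lemma inner_self_Jm (x : V) : ⟪x, S.J (S.m x)⟫_ℝ = 0 := by
  rw [← neg_eq_zero, ← S.J_skew, S.inner_J_m]

lemma hasFDerivAt_a (x : V) : HasFDerivAt S.a ((2 : ℝ) • innerSL ℝ (S.Q₁ x)) x := by
  have h := (hasFDerivAt_id x).inner ℝ S.Q₁.hasFDerivAt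
  refine h.congr_fderiv ?_
  ext v
  simp [fderivInnerCLM_apply]
  rw [← S.Q₁_symm, real_inner_comm (S.Q₁ x) v]
  ring

lemma hasFDerivAt_b (x : V) : HasFDerivAt S.b ((2 : ℝ) • innerSL ℝ (S.Q₂ x)) x := by
  have h := (hasFDerivAt_id x).inner ℝ S.Q₂.hasFDerivAt
  refine h.congr_fderiv ?_
  ext v
  simp [fderivInnerCLM_apply]
  rw [← S.Q₂_symm, real_inner_comm (S.Q₂ x) v]
  ring

lemma contDiff_a : ContDiff ℝ ∞ S.a := contDiff_id.inner ℝ S.Q₁.contDiff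

lemma contDiff_b : ContDiff ℝ ∞ S.b := contDiff_id.inner ℝ S.Q₂.contDiff

lemma contDiff_m : ContDiff ℝ ∞ S.m :=
  (S.contDiff_a.smul S.Q₂.contDiff).sub (S.contDiff_b.smul S.Q₁.contDiff)

lemma contDiff_μ : ContDiff ℝ ∞ S.μ := S.contDiff_m.inner ℝ S.contDiff_m

lemma fderiv_m (x v : V) : fderiv ℝ S.m x v =
    S.a x • S.Q₂ v + (2 * ⟪S.Q₁ x, v⟫_ℝ) • S.Q₂ x
      - (S.b x • S.Q₁ v + (2 * ⟪S.Q₂ x, v⟫_ℝ) • S.Q₁ x) := by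
  have h := ((S.hasFDerivAt_a x).smul (S.Q₂.hasFDerivAt (x := x))).sub
    ((S.hasFDerivAt_b x).smul (S.Q₁.hasFDerivAt (x := x)))
  have h' : fderiv ℝ S.m x = _ := h.fderiv
  rw [h']
  simp

lemma fderiv_m_J (x : V) : fderiv ℝ S.m x (S.J x) = S.J (S.m x) := by
  simp [S.fderiv_m, S.inner_Q₁_J, S.inner_Q₂_J, S.Q₁_J, S.Q₂_J, m]

lemma fderiv_m_A (x : V) : fderiv ℝ S.m x (S.A x) = S.A (S.m x) := by
  simp [S.fderiv_m, S.Q₁_A, S.Q₂_A, S.A_m, S.Q₁_symm, S.Q₂_symm]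

lemma fderiv_μ (x v : V) : fderiv ℝ S.μ x v = 2 * ⟪S.m x, fderiv ℝ S.m x v⟫_ℝ := by
  have hm := (S.contDiff_m.differentiable (by simp) x).hasFDerivAt
  have h' : fderiv ℝ S.μ x = _ := (hm.inner ℝ hm).fderiv
  rw [h']
  simp [fderivInnerCLM_apply]
  rw [real_inner_comm (S.m x)]
  ring

/-- The squared cosine `s` of the angle to the space where `Q₁ + Q₂ = 1`. -/
def s (x : V) : ℝ := S.a x + S.b x

/-- On the unit sphere, the gradient of `s / 2`. -/
def R (x : V) : V := S.Q₁ x + S.Q₂ x - S.s x • x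

lemma inner_self_R {x : V} (hx : ⟪x, x⟫_ℝ = 1) : ⟪x, S.R x⟫_ℝ = 0 := by
  rw [R, inner_sub_right, inner_add_right, inner_smul_right, ← a.eq_1, ← b.eq_1, hx, s]
  ring

lemma inner_J_R (x : V) : ⟪S.J x, S.R x⟫_ℝ = 0 := by
  rw [real_inner_comm]
  simp [R, inner_sub_left, inner_add_left, inner_smul_left, S.inner_Q₁_J, S.inner_Q₂_J,
    S.inner_self_J]

lemma inner_Q₁_m (x : V) : ⟪S.Q₁ x, S.m x⟫_ℝ = -(S.a x * S.b x) := by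
  rw [S.Q₁_symm, S.Q₁_m, inner_neg_right, inner_smul_right, ← a.eq_1]
  ring

lemma inner_Q₂_m (x : V) : ⟪S.Q₂ x, S.m x⟫_ℝ = S.a x * S.b x := by
  rw [S.Q₂_symm, S.Q₂_m, inner_smul_right, ← b.eq_1]

lemma inner_R_m (x : V) : ⟪S.R x, S.m x⟫_ℝ = 0 := by
  simp [R, inner_sub_left, inner_add_left, inner_smul_left, S.inner_Q₁_m, S.inner_Q₂_m,
    S.inner_self_m]

lemma inner_Q₁_Jm (x : V) : ⟪S.Q₁ x, S.J (S.m x)⟫_ℝ = 0 := by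
  rw [S.Q₁_symm, S.Q₁_J, S.Q₁_m]
  simp [inner_smul_right, ← S.Q₁_J, ← S.Q₁_symm, S.inner_Q₁_J]

lemma inner_Q₂_Jm (x : V) : ⟪S.Q₂ x, S.J (S.m x)⟫_ℝ = 0 := by
  rw [S.Q₂_symm, S.Q₂_J, S.Q₂_m]
  simp [inner_smul_right, ← S.Q₂_J, ← S.Q₂_symm, S.inner_Q₂_J]

lemma inner_R_Jm (x : V) : ⟪S.R x, S.J (S.m x)⟫_ℝ = 0 := by
  simp [R, inner_sub_left, inner_add_left, inner_smul_left, S.inner_Q₁_Jm, S.inner_Q₂_Jm,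
    S.inner_self_Jm]

lemma contDiff_s : ContDiff ℝ ∞ S.s := S.contDiff_a.add S.contDiff_b

lemma contDiff_R : ContDiff ℝ ∞ S.R :=
  (S.Q₁.contDiff.add S.Q₂.contDiff).sub (S.contDiff_s.smul contDiff_id)

lemma fderiv_R (x v : V) : fderiv ℝ S.R x v =
    S.Q₁ v + S.Q₂ v - (S.s x • v + (2 * ⟪S.Q₁ x + S.Q₂ x, v⟫_ℝ) • x) := by
  have hs : HasFDerivAt S.s _ x := (S.hasFDerivAt_a x).add (S.hasFDerivAt_b x)
  have h := (S.Q₁.hasFDerivAt.add S.Q₂.hasFDerivAt).sub (hs.smul (hasFDerivAt_id x))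
  have h' : fderiv ℝ S.R x = _ := h.fderiv
  rw [h']
  simp [inner_add_left]
  ring_nf

lemma Q₁_R (x : V) : S.Q₁ (S.R x) = (1 - S.s x) • S.Q₁ x := by
  simp [R, S.Q₁_Q₁, S.Q₁_Q₂, sub_smul]

lemma Q₂_R (x : V) : S.Q₂ (S.R x) = (1 - S.s x) • S.Q₂ x := by
  simp [R, S.Q₂_Q₂, S.Q₂_Q₁, sub_smul]

lemma inner_Q₁_R (x : V) : ⟪S.Q₁ x, S.R x⟫_ℝ = (1 - S.s x) * S.a x := by
  rw [S.Q₁_symm, S.Q₁_R, inner_smul_right, a]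

lemma inner_Q₂_R (x : V) : ⟪S.Q₂ x, S.R x⟫_ℝ = (1 - S.s x) * S.b x := by
  rw [S.Q₂_symm, S.Q₂_R, inner_smul_right, b]

/-- The homogeneity of `m` of degree `3`, along the gradient field. -/
lemma fderiv_m_R (x : V) : fderiv ℝ S.m x (S.R x) = (3 * (1 - S.s x)) • S.m x := by
  rw [S.fderiv_m, S.Q₁_R, S.Q₂_R, S.inner_Q₁_R, S.inner_Q₂_R, m]
  module

lemma fderiv_R_m (x : V) : fderiv ℝ S.R x (S.m x) = (1 - S.s x) • S.m x := by
  rw [S.fderiv_R, inner_add_left, S.inner_Q₁_m, S.inner_Q₂_m, S.Q₁_m, S.Q₂_m, m]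
  module

lemma fderiv_R_Jm (x : V) : fderiv ℝ S.R x (S.J (S.m x)) = (1 - S.s x) • S.J (S.m x) := by
  rw [S.fderiv_R, inner_add_left, S.inner_Q₁_Jm, S.inner_Q₂_Jm, S.Q₁_J, S.Q₂_J, S.Q₁_m, S.Q₂_m, m]
  simp only [map_sub, map_neg, map_smul]
  module

/-- `J R` acts on the image of `Q₁ + Q₂` as `(1 - s) J`. -/
lemma fderiv_m_JR (x : V) : fderiv ℝ S.m x (S.J (S.R x)) = (1 - S.s x) • S.J (S.m x) := by
  have h1 : S.Q₁ (S.J (S.R x)) = (1 - S.s x) • S.J (S.Q₁ x) := by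
    rw [S.Q₁_J, S.Q₁_R, map_smul]
  have h2 : S.Q₂ (S.J (S.R x)) = (1 - S.s x) • S.J (S.Q₂ x) := by
    rw [S.Q₂_J, S.Q₂_R, map_smul]
  have h3 : ⟪S.Q₁ x, S.J (S.R x)⟫_ℝ = 0 := by
    rw [S.Q₁_symm, h1, inner_smul_right, ← S.Q₁_J, ← S.Q₁_symm, S.inner_Q₁_J, mul_zero]
  have h4 : ⟪S.Q₂ x, S.J (S.R x)⟫_ℝ = 0 := by
    rw [S.Q₂_symm, h2, inner_smul_right, ← S.Q₂_J, ← S.Q₂_symm, S.inner_Q₂_J, mul_zero]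
  rw [S.fderiv_m, h1, h2, h3, h4, m]
  simp only [map_sub, map_smul]
  module

lemma inner_fderiv_m_m_R (x : V) :
    ⟪fderiv ℝ S.m x (S.m x), S.R x⟫_ℝ = -((1 - S.s x) * S.μ x) := by
  rw [S.fderiv_m, S.inner_Q₁_m, S.inner_Q₂_m, S.Q₁_m, S.Q₂_m, S.μ_eq]
  simp only [inner_sub_left, inner_add_left, inner_neg_left, real_inner_smul_left, smul_neg,
    S.inner_Q₁_R, S.inner_Q₂_R]
  ring

lemma inner_fderiv_m_Jm_JR (x : V) :
    ⟪fderiv ℝ S.m x (S.J (S.m x)), S.J (S.R x)⟫_ℝ = (1 - S.s x) * S.μ x := by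
  rw [S.fderiv_m, S.inner_Q₁_Jm, S.inner_Q₂_Jm, S.Q₁_J, S.Q₂_J, S.Q₁_m, S.Q₂_m, S.μ_eq]
  simp only [mul_zero, zero_smul, add_zero, map_neg, map_smul, inner_sub_left, inner_neg_left,
    real_inner_smul_left, smul_neg, S.inner_J_J, S.inner_Q₁_R, S.inner_Q₂_R]
  ring

end HermitianModel

/-! ### The deformed scalar product and its endomorphism `φ` -/

namespace HermitianModel

section Form

variable {V : Type*} [NormedAddCommGroup V] [InnerProductSpace ℝ V] (S : HermitianModel V)

/-- The coefficient of the deformation in the direction `J m`. It is chosen such that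
`(1 + t² μ) (1 + μ h) = 1`. -/
def h (t : ℝ) (x : V) : ℝ := -(t ^ 2 / (1 + t ^ 2 * S.μ x))

lemma one_add_pos (t : ℝ) (x : V) : 0 < 1 + t ^ 2 * S.μ x := by
  have := S.μ_nonneg x
  positivity

lemma h_mul (t : ℝ) (x : V) : S.h t x * (1 + t ^ 2 * S.μ x) = -t ^ 2 := by
  have := (S.one_add_pos t x).ne'
  rw [h]
  field_simp

/-- The Euclidean scalar product, as a bilinear form. -/
def euclideanForm : V →L[ℝ] V →L[ℝ] ℝ := innerSL ℝ

/-- The product of the linear forms `⟪u, ·⟫` and `⟪v, ·⟫`, as a bilinear form. -/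
def prodForm (u v : V) : V →L[ℝ] V →L[ℝ] ℝ := (innerSL ℝ u).smulRight (innerSL ℝ v)

lemma prodForm_apply (u u' v w : V) : prodForm u u' v w = ⟪u, v⟫_ℝ * ⟪u', w⟫_ℝ := by
  simp [prodForm]

lemma contDiff_prodForm {W : Type*} [NormedAddCommGroup W] [NormedSpace ℝ W] {u v : W → V}
    (hu : ContDiff ℝ ∞ u) (hv : ContDiff ℝ ∞ v) : ContDiff ℝ ∞ (fun p => prodForm (u p) (v p)) :=
  ((innerSL ℝ).contDiff.comp hu).smulRight ((innerSL ℝ).contDiff.comp hv)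

/-- The deformed scalar product at the point `x`. It differs from the Euclidean one only on the
complex line spanned by `m x`, where it has the same area form. -/
def form (t : ℝ) (x : V) : V →L[ℝ] V →L[ℝ] ℝ :=
  euclideanForm + prodForm ((t ^ 2) • S.m x) (S.m x)
    + prodForm (S.h t x • S.J (S.m x)) (S.J (S.m x))

lemma form_apply (t : ℝ) (x v w : V) : S.form t x v w = ⟪v, w⟫_ℝ
    + t ^ 2 * (⟪S.m x, v⟫_ℝ * ⟪S.m x, w⟫_ℝ)
    + S.h t x * (⟪S.J (S.m x), v⟫_ℝ * ⟪S.J (S.m x), w⟫_ℝ) := by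
  simp only [form, _root_.add_apply, prodForm_apply, real_inner_smul_left, mul_assoc]
  rfl

lemma contDiff_form_prod : ContDiff ℝ ∞ (fun p : ℝ × V => S.form p.1 p.2) := by
  have ht : ContDiff ℝ ∞ (fun p : ℝ × V => p.1 ^ 2) := contDiff_fst.pow 2
  have hm : ContDiff ℝ ∞ (fun p : ℝ × V => S.m p.2) := S.contDiff_m.comp contDiff_snd
  have hμ : ContDiff ℝ ∞ (fun p : ℝ × V => S.μ p.2) := S.contDiff_μ.comp contDiff_snd
  have hh : ContDiff ℝ ∞ (fun p : ℝ × V => S.h p.1 p.2) :=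
    (ht.div (contDiff_const.add (ht.mul hμ)) fun p => (S.one_add_pos p.1 p.2).ne').neg
  have hJ : ContDiff ℝ ∞ (fun p : ℝ × V => S.J (S.m p.2)) := S.J.contDiff.comp hm
  exact (contDiff_const.add (contDiff_prodForm (ht.smul hm) hm)).add
    (contDiff_prodForm (hh.smul hJ) hJ)

lemma contDiff_form (t : ℝ) : ContDiff ℝ ∞ (S.form t) :=
  ContDiff.comp (g := fun p : ℝ × V => S.form p.1 p.2) (f := fun x : V => (t, x))
    S.contDiff_form_prod (contDiff_prodMk_right t)

lemma form_symm (t : ℝ) (x v w : V) : S.form t x v w = S.form t x w v := by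
  rw [form_apply, form_apply, real_inner_comm v w]
  ring

lemma form_pos (t : ℝ) (x : V) : ∃ c > 0, ∀ w, c * ‖w‖ ^ 2 ≤ S.form t x w w := by
  have hp := S.one_add_pos t x
  refine ⟨1 / (1 + t ^ 2 * S.μ x), by positivity, fun w => ?_⟩
  have hcs := real_inner_mul_inner_self_le (S.J (S.m x)) w
  rw [S.inner_J_J, ← μ.eq_1, real_inner_self_eq_norm_sq] at hcs
  have h1 : 1 / (1 + t ^ 2 * S.μ x) * ‖w‖ ^ 2
      = ‖w‖ ^ 2 - t ^ 2 / (1 + t ^ 2 * S.μ x) * (S.μ x * ‖w‖ ^ 2) := by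
    field_simp
    ring
  have h2 : t ^ 2 / (1 + t ^ 2 * S.μ x) * (⟪S.J (S.m x), w⟫_ℝ * ⟪S.J (S.m x), w⟫_ℝ)
      ≤ t ^ 2 / (1 + t ^ 2 * S.μ x) * (S.μ x * ‖w‖ ^ 2) :=
    mul_le_mul_of_nonneg_left hcs (by positivity)
  have h3 : 0 ≤ t ^ 2 * (⟪S.m x, w⟫_ℝ * ⟪S.m x, w⟫_ℝ) :=
    mul_nonneg (sq_nonneg _) (mul_self_nonneg _)
  rw [h1, form_apply, h, real_inner_self_eq_norm_sq, neg_mul]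
  linarith

lemma form_zero (x v w : V) : S.form 0 x v w = ⟪v, w⟫_ℝ := by
  simp [form_apply, h]

lemma fderiv_form_apply (t : ℝ) (x u v w : V) :
    fderiv ℝ (S.form t) x u v w = fderiv ℝ (fun y => S.form t y v w) x u := by
  have hf := ((S.contDiff_form t).differentiable (by simp) x).hasFDerivAt
  have := ((hf.clm_apply (hasFDerivAt_const v x)).clm_apply (hasFDerivAt_const w x)).fderiv
  rw [this]
  simp

lemma fderiv_form_zero (x u v w : V) : fderiv ℝ (S.form 0) x u v w = 0 := by
  rw [fderiv_form_apply]
  simp [form_zero]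

/-- The deformed scalar product is invariant under the flow of a skew linear map which preserves
`m` and `J m`. -/
lemma form_invariant (t : ℝ) {L : V →L[ℝ] V} (hL : ∀ x y, ⟪L x, y⟫_ℝ = -⟪x, L y⟫_ℝ) {x : V}
    (hm : fderiv ℝ S.m x (L x) = L (S.m x)) (hJ : L (S.J (S.m x)) = S.J (L (S.m x))) (v w : V) :
    fderiv ℝ (S.form t) x (L x) v w + S.form t x (L v) w + S.form t x v (L w) = 0 := by
  have h1 := S.fderiv_form_apply t x (L x) v w
  have hmd := (S.contDiff_m.differentiable (by simp) x).hasFDerivAt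
  have hJmd : HasFDerivAt (fun y => S.J (S.m y)) _ x := S.J.hasFDerivAt.comp x hmd
  have hμd := (S.contDiff_μ.differentiable (by simp) x).hasFDerivAt
  have hself : ⟪S.m x, L (S.m x)⟫_ℝ = 0 := by
    have h := hL (S.m x) (S.m x)
    rw [real_inner_comm] at h
    linarith
  -- `h` is a function of `μ`, which is constant along the flow
  obtain ⟨k, hk⟩ : ∃ k, HasFDerivAt (S.h t) (k • fderiv ℝ S.μ x) x := by
    have hd : DifferentiableAt ℝ (fun r : ℝ => -(t ^ 2 / (1 + t ^ 2 * r))) (S.μ x) := by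
      have := (S.one_add_pos t x).ne'
      fun_prop (disch := assumption)
    exact ⟨_, hd.hasDerivAt.comp_hasFDerivAt x hμd⟩
  have hk0 : fderiv ℝ S.μ x (L x) = 0 := by
    rw [S.fderiv_μ, hm, hself, mul_zero]
  have hi : ∀ u, HasFDerivAt (fun y => ⟪S.m y, u⟫_ℝ) _ x :=
    fun u => hmd.inner ℝ (hasFDerivAt_const u x)
  have hi' : ∀ u, HasFDerivAt (fun y => ⟪S.J (S.m y), u⟫_ℝ) _ x :=
    fun u => hJmd.inner ℝ (hasFDerivAt_const u x)
  have h2 := ((((hi v).mul (hi w)).const_mul (t ^ 2)).const_add ⟪v, w⟫_ℝ).add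
    (hk.mul ((hi' v).mul (hi' w)))
  have h3 : fderiv ℝ (fun y => S.form t y v w) x = _ :=
    (h2.congr_of_eventuallyEq (Filter.Eventually.of_forall fun y => S.form_apply t y v w)).fderiv
  rw [h1, h3, form_apply, form_apply]
  have e1 := hL (S.m x) v
  have e2 := hL (S.m x) w
  have e3 := hL (S.J (S.m x)) v
  have e4 := hL (S.J (S.m x)) w
  have e5 := hL v w
  rw [hJ] at e3 e4
  simp [fderivInnerCLM_apply, hk0, hm]
  rw [e1, e2, e3, e4, e5]
  ring

lemma form_J (t : ℝ) (x v : V) : S.form t x (S.J x) v = ⟪S.J x, v⟫_ℝ := by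
  rw [form_apply, real_inner_comm, real_inner_comm (S.J x) (S.m x), S.inner_J_m,
    real_inner_comm (S.J x) (S.J (S.m x)), S.inner_J_Jm]
  rw [real_inner_comm]
  ring

lemma form_m (t : ℝ) (x v : V) :
    S.form t x (S.m x) v = (1 + t ^ 2 * S.μ x) * ⟪S.m x, v⟫_ℝ := by
  rw [form_apply, ← μ.eq_1, real_inner_comm (S.m x) (S.J (S.m x)), S.inner_self_J]
  ring

lemma form_R (t : ℝ) (x v : V) : S.form t x (S.R x) v = ⟪S.R x, v⟫_ℝ := by
  rw [form_apply, real_inner_comm (S.R x) (S.m x), S.inner_R_m,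
    real_inner_comm (S.R x) (S.J (S.m x)), S.inner_R_Jm]
  ring

lemma form_JR (t : ℝ) (x v : V) : S.form t x (S.J (S.R x)) v = ⟪S.J (S.R x), v⟫_ℝ := by
  have h1 : ⟪S.m x, S.J (S.R x)⟫_ℝ = 0 := by
    rw [real_inner_comm, S.J_skew, S.inner_R_Jm, neg_zero]
  rw [form_apply, h1, S.inner_J_J, real_inner_comm (S.R x) (S.m x), S.inner_R_m]
  ring

lemma form_A (t : ℝ) (x v : V) : S.form t x (S.A x) v = ⟪S.A x, v⟫_ℝ := by
  have h1 : ⟪S.m x, S.A x⟫_ℝ = 0 := by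
    rw [real_inner_comm, S.A_skew, S.A_m, inner_zero_right, neg_zero]
  have h2 : ⟪S.J (S.m x), S.A x⟫_ℝ = 0 := by
    rw [real_inner_comm, S.A_skew, S.A_J, S.A_m, map_zero, neg_zero, inner_zero_right, neg_zero]
  rw [form_apply, h1, h2]
  ring

/-- The endomorphism `φ` of the deformed metric: `g(φ v, w) = ⟪J v, w⟫` for tangent `w`. -/
def phi (t : ℝ) (x w : V) : V :=
  S.J w + (t ^ 2 * ⟪S.m x, w⟫_ℝ) • S.J (S.m x) - (S.h t x * ⟪S.J (S.m x), w⟫_ℝ) • S.m x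
    + ⟪S.J x, w⟫_ℝ • x

lemma inner_self_phi {x : V} (hx : ⟪x, x⟫_ℝ = 1) (t : ℝ) (w : V) : ⟪x, S.phi t x w⟫_ℝ = 0 := by
  rw [phi, inner_add_right, inner_sub_right, inner_add_right, inner_smul_right, inner_smul_right,
    inner_smul_right, S.inner_self_Jm, S.inner_self_m, hx]
  linear_combination S.J_skew x w

lemma inner_m_phi (t : ℝ) (x w : V) :
    ⟪S.m x, S.phi t x w⟫_ℝ = -(1 + S.h t x * S.μ x) * ⟪S.J (S.m x), w⟫_ℝ := by
  rw [phi, inner_add_right, inner_sub_right, inner_add_right, inner_smul_right, inner_smul_right,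
    inner_smul_right, S.inner_self_J, ← μ.eq_1, real_inner_comm x, S.inner_self_m, S.J_skew]
  ring

lemma inner_Jm_phi (t : ℝ) (x w : V) :
    ⟪S.J (S.m x), S.phi t x w⟫_ℝ = (1 + t ^ 2 * S.μ x) * ⟪S.m x, w⟫_ℝ := by
  rw [phi, inner_add_right, inner_sub_right, inner_add_right, inner_smul_right, inner_smul_right,
    inner_smul_right, S.inner_J_J, S.inner_J_J, ← μ.eq_1, real_inner_comm x (S.J (S.m x)),
    S.inner_self_Jm, real_inner_comm (S.m x) (S.J (S.m x)), S.inner_self_J]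
  ring

lemma form_phi (t : ℝ) {x z : V} (hz : ⟪x, z⟫_ℝ = 0) (w : V) :
    S.form t x (S.phi t x w) z = ⟪S.J w, z⟫_ℝ := by
  rw [form_apply, S.inner_m_phi, S.inner_Jm_phi, phi, inner_add_left, inner_sub_left,
    inner_add_left, real_inner_smul_left, real_inner_smul_left, real_inner_smul_left, hz]
  linear_combination (⟪S.J (S.m x), z⟫_ℝ * ⟪S.m x, w⟫_ℝ - ⟪S.J (S.m x), w⟫_ℝ * ⟪S.m x, z⟫_ℝ)
    * S.h_mul t x

lemma phi_phi {x : V} (t : ℝ) {w : V} (hw : ⟪x, w⟫_ℝ = 0) :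
    S.phi t x (S.phi t x w) = -w + ⟪S.J x, w⟫_ℝ • S.J x := by
  have h0 : ⟪S.J x, x⟫_ℝ = 0 := by rw [real_inner_comm, S.inner_self_J]
  have hJ : ⟪S.J x, S.phi t x w⟫_ℝ = 0 := by
    rw [phi, inner_add_right, inner_sub_right, inner_add_right, inner_smul_right, inner_smul_right,
      inner_smul_right, S.inner_J_J, S.inner_J_Jm, S.inner_J_m, h0, hw]
    ring
  have e := S.h_mul t x
  have e1 : t ^ 2 * -(1 + S.h t x * S.μ x) = S.h t x := by linear_combination -e
  rw [phi, hJ, S.inner_m_phi, S.inner_Jm_phi, ← mul_assoc, ← mul_assoc, e, e1, phi]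
  simp only [map_add, map_sub, map_smul, S.J_J]
  module

end Form

end HermitianModel

/-! ### The deformed metrics on the sphere -/

section Koszul

variable {d : ℕ} {G : Ambient d → Ambient d →L[ℝ] Ambient d →L[ℝ] ℝ} {hG : ContDiff ℝ ∞ G}
  {hsymm : ∀ x v w, G x v w = G x w v} {hpos : ∀ x, ∃ c > 0, ∀ w, c * ‖w‖ ^ 2 ≤ G x w w}

lemma dirDeriv_pairing_sphereField {F H K : Ambient d → Ambient d} (hF : IsTangent F)
    (hH : IsTangent H) (hK : IsTangent K) {p : Ambient d → ℝ}
    (hp : ∀ x : Sphere d, G x (H x) (K x) = p x) {x : Sphere d} (hpd : DifferentiableAt ℝ p x) :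
    dirDeriv (sphereField F)
      (pairing (sphereMetric G hG hsymm hpos) (sphereField H) (sphereField K)) x =
      fderiv ℝ p x (F x) := by
  have h1 : pairing (sphereMetric G hG hsymm hpos) (sphereField H) (sphereField K) =
      fun y : Sphere d => p y := by
    funext y
    rw [pairing, sphereMetric_inner, dincl_sphereField hH, dincl_sphereField hK, hp]
  rw [h1, dirDeriv, mvfderiv_comp_incl hpd, dincl_sphereField hF]

lemma dirDeriv_pairing_sphereField_eq_zero {X : VField (𝓡 d) (Sphere d)}
    {H K : Ambient d → Ambient d}
    (hH : IsTangent H) (hK : IsTangent K) (hp : ∀ x : Sphere d, G x (H x) (K x) = 0)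
    (x : Sphere d) :
    dirDeriv X (pairing (sphereMetric G hG hsymm hpos) (sphereField H) (sphereField K)) x = 0 := by
  have h1 : pairing (sphereMetric G hG hsymm hpos) (sphereField H) (sphereField K) =
      fun _ : Sphere d => (0 : ℝ) := by
    funext y
    rw [pairing, sphereMetric_inner, dincl_sphereField hH, dincl_sphereField hK, hp]
  rw [h1, dirDeriv, mvfderiv_const]
  rfl

end Koszul

namespace HermitianModel

variable {d : ℕ} (S : HermitianModel (Ambient d))

/-- The deformed metric on the sphere. -/
def metric (t : ℝ) : RiemMetric (𝓡 d) (Sphere d) :=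
  sphereMetric (S.form t) (S.contDiff_form t) (S.form_symm t) (S.form_pos t)

lemma metric_inner (t : ℝ) (x : Sphere d) (v w : TangentSpace (𝓡 d) x) :
    (S.metric t).inner x v w = S.form t x (dincl x v) (dincl x w) := rfl

lemma isSmoothFamily_metric : IsSmoothFamily S.metric := by
  have h := contMDiff_inducedForm_family (f := incl d) contMDiff_incl S.contDiff_form_prod
  have e : ∀ p : ℝ × Sphere d, (S.metric p.1).inner p.2 =
      inducedForm (incl d) (S.form p.1 (incl d p.2)) p.2 := fun p => rfl
  unfold IsSmoothFamily
  simp_rw [e]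
  exact h

lemma isRound_metric_zero : IsRound (S.metric 0) := by
  intro x v w
  rw [S.metric_inner, S.form_zero]
  rfl

lemma isTangent_J : IsTangent S.J := fun x => S.inner_self_J x

lemma isTangent_A : IsTangent S.A := fun x => S.inner_self_A x

lemma isTangent_m : IsTangent S.m := fun x => S.inner_self_m x

lemma isTangent_Jm : IsTangent (fun x => S.J (S.m x)) := fun x => S.inner_self_Jm x

lemma isTangent_R : IsTangent S.R := fun x => S.inner_self_R (inner_self_sphere x)

lemma isTangent_JR : IsTangent (fun x => S.J (S.R x)) := fun x => by
  rw [← neg_eq_zero, ← S.J_skew, S.inner_J_R]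

/-- The Hopf vector field. -/
def reeb : VField (𝓡 d) (Sphere d) := sphereField S.J

lemma dincl_reeb (x : Sphere d) : dincl x (S.reeb x) = S.J x := dincl_sphereField S.isTangent_J x

lemma isKilling_of_skew (t : ℝ) {L : Ambient d →L[ℝ] Ambient d}
    (hL : ∀ x y, ⟪L x, y⟫_ℝ = -⟪x, L y⟫_ℝ) (hT : IsTangent L)
    (hm : ∀ x, fderiv ℝ S.m x (L x) = L (S.m x))
    (hJ : ∀ x, L (S.J (S.m x)) = S.J (L (S.m x))) :
    IsKilling (S.metric t) (sphereField L) := by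
  refine isKilling_sphereField hT L.contDiff fun x v w => ?_
  rw [L.fderiv]
  exact S.form_invariant t hL (hm x) (hJ x) v w

lemma isKilling_reeb (t : ℝ) : IsKilling (S.metric t) S.reeb :=
  S.isKilling_of_skew t S.J_skew S.isTangent_J S.fderiv_m_J fun _ => rfl

lemma isKilling_A (t : ℝ) : IsKilling (S.metric t) (sphereField S.A) :=
  S.isKilling_of_skew t S.A_skew S.isTangent_A S.fderiv_m_A fun x => by
    rw [S.A_J, S.A_m, map_zero, neg_zero]

lemma isUnitField_reeb (t : ℝ) : IsUnitField (S.metric t) S.reeb := by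
  intro x
  rw [S.metric_inner, S.dincl_reeb, S.form_J, S.inner_J_J, inner_self_sphere]

/-- The contact form does not depend on the deformation parameter. -/
lemma dDual_reeb (t : ℝ) {Y Z : VField (𝓡 d) (Sphere d)} (hY : SmoothField Y) (hZ : SmoothField Z)
    (x : Sphere d) :
    dDual (S.metric t) S.reeb Y Z x = 2 * ⟪S.J (dincl x (Y x)), dincl x (Z x)⟫_ℝ := by
  have hξ : SmoothField S.reeb := smoothField_sphereField S.J.contDiff
  have hpair : ∀ W : VField (𝓡 d) (Sphere d),
      pairing (S.metric t) S.reeb W = pairing (S.metric 0) S.reeb W := by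
    intro W
    funext y
    rw [pairing, pairing, S.metric_inner, S.metric_inner, S.dincl_reeb, S.form_J, S.form_J]
  have hder : ∀ U W : VField (𝓡 d) (Sphere d), SmoothField W →
      dirDeriv U (pairing (S.metric t) S.reeb W) x =
        ⟪S.J (dincl x (U x)), dincl x (W x)⟫_ℝ
          + ⟪S.J x, mvfderiv (𝓡 d) (ambientField W) x (U x)⟫_ℝ := by
    intro U W hW
    rw [hpair, metric, dirDeriv_pairing_sphereMetric (hξ.mdiffAt x) (hW.mdiffAt x), S.dincl_reeb,
      S.fderiv_form_zero, S.form_zero, S.form_zero, reeb,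
      mvfderiv_ambientField_sphereField S.isTangent_J S.J.contDiff, S.J.fderiv, zero_add]
  rw [dDual, hder Y Z hZ, hder Z Y hY, S.metric_inner, S.dincl_reeb, S.form_J,
    dincl_mlieBracket (hY.mdiffAt x) (hZ.mdiffAt x), inner_sub_right, S.J_skew (dincl x (Z x)),
    real_inner_comm (S.J (dincl x (Y x))) (dincl x (Z x))]
  ring

/-- The covariant derivative of the Hopf field is the endomorphism `φ`. -/
lemma dincl_leviCivita_reeb (t : ℝ) (x : Sphere d) (v : TangentSpace (𝓡 d) x) :
    dincl x (leviCivita (S.metric t) S.reeb x v) = S.phi t x (dincl x v) := by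
  have hphi := S.inner_self_phi (inner_self_sphere x) t (dincl x v)
  have hu : dincl x (tangentPart x (S.phi t x (dincl x v))) = S.phi t x (dincl x v) := by
    rw [dincl_tangentPart, hphi, zero_smul, sub_zero]
  rw [← hu]
  congr 1
  apply flat_injective (S.metric t) x
  ext z
  change (S.metric t).inner x _ z = (S.metric t).inner x _ z
  rw [S.metric_inner t x (tangentPart x _), hu, S.form_phi t (inner_dincl x z)]
  have hv : SmoothField (sphereField fun _ => dincl x v) := smoothField_sphereField contDiff_const
  have hz : SmoothField (sphereField fun _ => dincl x z) := smoothField_sphereField contDiff_const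
  have key := inner_leviCivita_killing (S.isKilling_reeb t) hv hz x
  rw [S.dDual_reeb t hv hz, sphereField_const, sphereField_const] at key
  rw [key]
  ring

lemma isKContact_reeb (t : ℝ) : IsKContact (S.metric t) S.reeb := by
  have hk := S.isKilling_reeb t
  refine ⟨⟨hk.1, S.isUnitField_reeb t, leviCivita (S.metric t) S.reeb, ?_, ?_⟩, hk⟩
  · intro X Y hX hY x
    exact inner_leviCivita_killing hk hX hY x
  · intro x v
    apply dincl_injective x
    rw [S.dincl_leviCivita_reeb, S.dincl_leviCivita_reeb, S.phi_phi t (inner_dincl x v), map_add,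
      map_neg, map_smul, S.dincl_reeb, S.metric_inner, S.dincl_reeb, S.form_J]

lemma A_mem_killingComponent (t : ℝ) :
    sphereField S.A ∈ killingComponent (S.metric t) S.reeb 2 := by
  refine ⟨S.isKilling_A t, fun x => ?_⟩
  have hT : IsTangent ((-2 : ℝ) • S.J.comp S.A : Ambient d →L[ℝ] Ambient d) := fun y => by
    change ⟪(y : Ambient d), (-2 : ℝ) • S.J (S.A y)⟫_ℝ = 0
    have h1 := S.J_skew y (S.A y)
    have h2 := S.A_skew y (S.J y)
    rw [S.A_J, inner_neg_right, neg_neg, real_inner_comm] at h2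
    rw [inner_smul_right]
    linarith
  have h1 : mlieBracket (𝓡 d) S.reeb (sphereField S.A) =
      sphereField ((-2 : ℝ) • S.J.comp S.A : Ambient d →L[ℝ] Ambient d) := by
    funext y
    apply dincl_injective y
    rw [reeb, dincl_mlieBracket_sphereField S.isTangent_J S.J.contDiff S.isTangent_A S.A.contDiff,
      dincl_sphereField hT, S.J.fderiv, S.A.fderiv, S.A_J]
    change _ = (-2 : ℝ) • S.J (S.A y)
    module
  rw [h1]
  apply dincl_injective x
  rw [reeb, dincl_mlieBracket_sphereField S.isTangent_J S.J.contDiff hT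
    (ContinuousLinearMap.contDiff _), S.J.fderiv, ContinuousLinearMap.fderiv, map_smul,
    dincl_sphereField S.isTangent_A]
  change (-2 : ℝ) • S.J (S.A (S.J x)) - S.J ((-2 : ℝ) • S.J (S.A x)) = _
  rw [S.A_J, map_neg, map_smul, S.J_J]
  norm_num
  module

lemma not_hasConstantLength_A (t : ℝ) {x y : Sphere d} (hx : S.A x = 0) (hy : S.A y ≠ 0) :
    ¬ HasConstantLength (S.metric t) (sphereField S.A) := by
  have hlen : ∀ z : Sphere d,
      (S.metric t).inner z (sphereField S.A z) (sphereField S.A z) = ⟪S.A z, S.A z⟫_ℝ := fun z => by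
    rw [S.metric_inner, dincl_sphereField S.isTangent_A, S.form_A]
  rintro ⟨c, hc⟩
  have h1 := hc x
  have h2 := hc y
  rw [hlen, hx, inner_zero_left, Real.sqrt_zero] at h1
  rw [hlen, ← h1, Real.sqrt_eq_zero real_inner_self_nonneg] at h2
  exact hy (inner_self_eq_zero.1 h2)

/-- Twice `g(∇_m R, m)`, which measures how the metric on the line spanned by `m` varies along the
gradient field `R`. -/
lemma koszul_m_R_m (t : ℝ) (x : Sphere d) :
    koszul (S.metric t) (sphereField S.m) (sphereField S.R) (sphereField S.m) x =
      (1 - S.s x) * (2 * S.μ x + 8 * t ^ 2 * S.μ x ^ 2) := by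
  have hm := S.isTangent_m
  have hR := S.isTangent_R
  have hμd : HasFDerivAt S.μ (fderiv ℝ S.μ x) x :=
    (S.contDiff_μ.differentiable (by simp) x).hasFDerivAt
  have hpd : HasFDerivAt (fun y => (1 + t ^ 2 * S.μ y) * S.μ y) _ (x : Ambient d) :=
    ((hμd.const_mul (t ^ 2)).const_add 1).mul hμd
  have hbr : dincl x (mlieBracket (𝓡 d) (sphereField S.m) (sphereField S.R) x) =
      (-2 * (1 - S.s x)) • S.m x := by
    rw [dincl_mlieBracket_sphereField hm S.contDiff_m hR S.contDiff_R, S.fderiv_R_m, S.fderiv_m_R]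
    module
  have hbr' : dincl x (mlieBracket (𝓡 d) (sphereField S.R) (sphereField S.m) x) =
      (2 * (1 - S.s x)) • S.m x := by
    rw [mlieBracket_swap_apply, map_neg, hbr]
    module
  have hself : dincl x (mlieBracket (𝓡 d) (sphereField S.m) (sphereField S.m) x) = 0 := by
    rw [dincl_mlieBracket_sphereField hm S.contDiff_m hm S.contDiff_m, sub_self]
  have hμR : fderiv ℝ S.μ x (S.R x) = 6 * (1 - S.s x) * S.μ x := by
    rw [S.fderiv_μ, S.fderiv_m_R, inner_smul_right, ← μ.eq_1]
    ring
  have hz1 : ∀ y : Sphere d, S.form t y (S.R y) (S.m y) = 0 := fun y => by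
    rw [S.form_R, S.inner_R_m]
  have hz2 : ∀ y : Sphere d, S.form t y (S.m y) (S.R y) = 0 := fun y => by
    rw [S.form_symm, hz1]
  rw [koszul]
  simp only [S.metric_inner, hbr, hbr', hself, dincl_sphereField hm, dincl_sphereField hR]
  rw [metric, dirDeriv_pairing_sphereField_eq_zero hR hm hz1,
    dirDeriv_pairing_sphereField_eq_zero hm hR hz2,
    dirDeriv_pairing_sphereField hR hm hm (fun y => S.form_m t y (S.m y)) hpd.differentiableAt]
  have hpd' := hpd.fderiv
  rw [hpd']
  simp only [map_smul, map_zero, _root_.add_apply, _root_.smul_apply, _root_.zero_apply,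
    smul_eq_mul, hμR, S.form_m, ← μ.eq_1]
  ring

/-- Twice `g(∇_m (J R), J m)`, which does not depend on the deformation. -/
lemma koszul_m_JR_Jm (t : ℝ) (x : Sphere d) :
    koszul (S.metric t) (sphereField S.m) (sphereField fun y => S.J (S.R y))
      (sphereField fun y => S.J (S.m y)) x = 2 * (1 - S.s x) * S.μ x := by
  have hm := S.isTangent_m
  have hJm := S.isTangent_Jm
  have hJR := S.isTangent_JR
  have cm := S.contDiff_m
  have cJm : ContDiff ℝ ∞ (fun y => S.J (S.m y)) := S.J.contDiff.comp cm
  have cJR : ContDiff ℝ ∞ (fun y => S.J (S.R y)) := S.J.contDiff.comp S.contDiff_R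
  have dJm : ∀ v, fderiv ℝ (fun y => S.J (S.m y)) x v = S.J (fderiv ℝ S.m x v) := fun v => by
    have h1 : fderiv ℝ (fun y => S.J (S.m y)) x = _ :=
      (S.J.hasFDerivAt.comp (x : Ambient d)
        (cm.differentiable (by simp) (x : Ambient d)).hasFDerivAt).fderiv
    rw [h1]; rfl
  have dJR : ∀ v, fderiv ℝ (fun y => S.J (S.R y)) x v = S.J (fderiv ℝ S.R x v) := fun v => by
    have h1 : fderiv ℝ (fun y => S.J (S.R y)) x = _ :=
      (S.J.hasFDerivAt.comp (x : Ambient d)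
        (S.contDiff_R.differentiable (by simp) (x : Ambient d)).hasFDerivAt).fderiv
    rw [h1]; rfl
  have hbr1 : dincl x (mlieBracket (𝓡 d) (sphereField S.m)
      (sphereField fun y => S.J (S.R y)) x) = 0 := by
    rw [dincl_mlieBracket_sphereField hm cm hJR cJR, dJR, S.fderiv_R_m, S.fderiv_m_JR, map_smul,
      sub_self]
  have hbr2 : dincl x (mlieBracket (𝓡 d) (sphereField fun y => S.J (S.R y))
      (sphereField fun y => S.J (S.m y)) x) = 0 := by
    rw [dincl_mlieBracket_sphereField hJR cJR hJm cJm, dJR, dJm, S.fderiv_R_Jm, S.fderiv_m_JR,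
      sub_self]
  have hbr3 : dincl x (mlieBracket (𝓡 d) (sphereField S.m)
      (sphereField fun y => S.J (S.m y)) x) =
        S.J (fderiv ℝ S.m x (S.m x)) - fderiv ℝ S.m x (S.J (S.m x)) := by
    rw [dincl_mlieBracket_sphereField hm cm hJm cJm, dJm]
  have hz0 : ∀ y, ⟪S.J (S.R y), S.m y⟫_ℝ = 0 := fun y => by
    rw [S.J_skew, S.inner_R_Jm, neg_zero]
  have hz1 : ∀ y : Sphere d, S.form t y (S.J (S.R y)) (S.J (S.m y)) = 0 := fun y => by
    rw [S.form_JR, S.inner_J_J, S.inner_R_m]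
  have hz2 : ∀ y : Sphere d, S.form t y (S.m y) (S.J (S.m y)) = 0 := fun y => by
    rw [S.form_m, S.inner_self_J, mul_zero]
  have hz3 : ∀ y : Sphere d, S.form t y (S.m y) (S.J (S.R y)) = 0 := fun y => by
    rw [S.form_symm, S.form_JR, hz0]
  rw [koszul]
  simp only [S.metric_inner, hbr1, hbr2, hbr3, dincl_sphereField hm, dincl_sphereField hJR,
    dincl_sphereField hJm]
  rw [metric, dirDeriv_pairing_sphereField_eq_zero hJR hJm hz1,
    dirDeriv_pairing_sphereField_eq_zero hm hJm hz2,
    dirDeriv_pairing_sphereField_eq_zero hm hJR hz3,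
    S.form_symm t x _ (S.J (S.R x)), S.form_JR, inner_sub_right, S.inner_J_J,
    real_inner_comm (fderiv ℝ S.m x (S.m x)), S.inner_fderiv_m_m_R,
    real_inner_comm (fderiv ℝ S.m x (S.J (S.m x))), S.inner_fderiv_m_Jm_JR]
  simp only [map_zero, _root_.zero_apply]
  ring

/-- The deformed structure is not Sasakian: in the Sasaki identity for `X = m` and `Y = R`, paired
with `J m`, only the term `g(∇_m R, m)` depends on the deformation. -/
lemma not_isSasakian_reeb {t : ℝ} (ht : t ≠ 0) {x : Sphere d} (hμ : S.μ x ≠ 0) (hs : S.s x ≠ 1) :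
    ¬ IsSasakian (S.metric t) S.reeb := by
  rintro ⟨-, -, hsas⟩
  have hm := S.isTangent_m
  have hR := S.isTangent_R
  have hJm := S.isTangent_Jm
  have hJR := S.isTangent_JR
  have sm : SmoothField (sphereField S.m : VField (𝓡 d) (Sphere d)) :=
    smoothField_sphereField S.contDiff_m
  have sR : SmoothField (sphereField S.R : VField (𝓡 d) (Sphere d)) :=
    smoothField_sphereField S.contDiff_R
  have sJm : SmoothField (sphereField (fun y => S.J (S.m y)) : VField (𝓡 d) (Sphere d)) :=
    smoothField_sphereField (S.J.contDiff.comp S.contDiff_m)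
  have sJR : SmoothField (sphereField (fun y => S.J (S.R y)) : VField (𝓡 d) (Sphere d)) :=
    smoothField_sphereField (S.J.contDiff.comp S.contDiff_R)
  have h := hsas _ _ sm sR x
  -- `∇_R ξ = φ R = J R`, since `R` is orthogonal to `m` and `J m`
  have hfield : (fun y => leviCivita (S.metric t) S.reeb y (sphereField S.R y)) =
      sphereField fun y => S.J (S.R y) := by
    funext y
    apply dincl_injective y
    rw [S.dincl_leviCivita_reeb, dincl_sphereField hR, dincl_sphereField hJR, phi,
      real_inner_comm (S.R y) (S.m y), S.inner_R_m, real_inner_comm (S.R y) (S.J (S.m y)),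
      S.inner_R_Jm, S.inner_J_R]
    simp
  rw [hfield] at h
  have hpair := congrArg
    (fun w => (S.metric t).inner x w (sphereField (fun y => S.J (S.m y)) x)) h
  set u := leviCivita (S.metric t) (sphereField S.R) x (sphereField S.m x) with hu
  -- the right-hand side of the Sasaki identity vanishes
  have e1 : (S.metric t).inner x (S.reeb x) (sphereField S.R x) = 0 := by
    rw [S.metric_inner, S.dincl_reeb, S.form_J, dincl_sphereField hR, S.inner_J_R]
  have e2 : (S.metric t).inner x (sphereField S.m x) (sphereField S.R x) = 0 := by
    rw [S.metric_inner, dincl_sphereField hm, dincl_sphereField hR, S.form_symm, S.form_R,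
      S.inner_R_m]
  have e3 : (S.metric t).inner x (leviCivita (S.metric t) S.reeb x u)
      (sphereField (fun y => S.J (S.m y)) x) = ⟪dincl x u, S.m x⟫_ℝ := by
    rw [S.metric_inner, S.dincl_leviCivita_reeb, dincl_sphereField hJm,
      S.form_phi t (S.inner_self_Jm x), S.inner_J_J]
  have k1 := two_mul_inner_leviCivitaFun (S.metric t) (sm.mdiffAt x) (sJR.mdiffAt x) (sJm.mdiffAt x)
  have k2 := two_mul_inner_leviCivitaFun (S.metric t) (sm.mdiffAt x) (sR.mdiffAt x) (sm.mdiffAt x)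
  rw [S.koszul_m_JR_Jm] at k1
  rw [S.koszul_m_R_m] at k2
  change 2 * (S.metric t).inner x u (sphereField S.m x) = _ at k2
  rw [S.metric_inner, dincl_sphereField hm, S.form_symm, S.form_m, real_inner_comm] at k2
  change 2 * (S.metric t).inner x (leviCivita (S.metric t) (sphereField fun y => S.J (S.R y)) x
    (sphereField S.m x)) (sphereField (fun y => S.J (S.m y)) x) = _ at k1
  simp only [e1, e2, zero_smul, sub_zero, map_zero, map_sub, _root_.sub_apply,
    _root_.zero_apply] at hpair
  rw [e3] at hpair
  -- multiply the Sasaki identity by `1 + t² μ` and insert the two Koszul formulas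
  have hfin : (1 - S.s x) * (t ^ 2 * S.μ x ^ 2) = 0 := by
    linear_combination (-1 / 6 : ℝ) * (k2 - (1 + t ^ 2 * S.μ x) * (k1 - 2 * hpair))
  have h1 : (1 - S.s x) ≠ 0 := sub_ne_zero.2 (Ne.symm hs)
  exact mul_ne_zero h1 (mul_ne_zero (pow_ne_zero 2 ht) (pow_ne_zero 2 hμ)) hfin

end HermitianModel

/-! ### The standard model in `ℂⁿ⁺¹` -/

section SignedPermutation

variable {ι : Type*} [Fintype ι]

/-- The linear map whose `i`-th component is `ε i` times the `σ i`-th coordinate. -/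
def weightedPerm (σ : ι → ι) (ε : ι → ℝ) : EuclideanSpace ℝ ι →L[ℝ] EuclideanSpace ℝ ι :=
  LinearMap.toContinuousLinearMap
    { toFun := fun x => WithLp.toLp 2 fun i => ε i * x (σ i)
      map_add' := fun x y => by ext i; simp [mul_add]
      map_smul' := fun c x => by ext i; simp [mul_left_comm] }

lemma weightedPerm_apply (σ : ι → ι) (ε : ι → ℝ) (x : EuclideanSpace ℝ ι) (i : ι) :
    weightedPerm σ ε x i = ε i * x (σ i) := rfl

lemma inner_weightedPerm {σ : ι → ι} (hσ : Involutive σ) {ε : ι → ℝ} {c : ℝ}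
    (hε : ∀ i, ε (σ i) = c * ε i) (x y : EuclideanSpace ℝ ι) :
    ⟪weightedPerm σ ε x, y⟫_ℝ = c * ⟪x, weightedPerm σ ε y⟫_ℝ := by
  simp only [PiLp.inner_apply, weightedPerm_apply, Finset.mul_sum]
  rw [← Equiv.sum_comp hσ.toPerm]
  refine Finset.sum_congr rfl fun i _ => ?_
  simp only [Involutive.coe_toPerm, hσ i, hε, RCLike.inner_apply, conj_trivial]
  ring

end SignedPermutation

section StandardModel

variable {n : ℕ}

/-- The involution exchanging the two real coordinates of each complex coordinate. -/
def rotIndex (i : Fin (2 * n + 1 + 1)) : Fin (2 * n + 1 + 1) :=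
  if h : i.val % 2 = 0 then ⟨i.val + 1, by omega⟩ else ⟨i.val - 1, by omega⟩

/-- The involution exchanging the first two complex coordinates. -/
def swapIndex (hn : 3 ≤ n) (i : Fin (2 * n + 1 + 1)) : Fin (2 * n + 1 + 1) :=
  if h : i.val < 2 then ⟨i.val + 2, by omega⟩
  else if h : i.val < 4 then ⟨i.val - 2, by omega⟩ else i

lemma rotIndex_val (i : Fin (2 * n + 1 + 1)) :
    (rotIndex i).val = if i.val % 2 = 0 then i.val + 1 else i.val - 1 := by
  unfold rotIndex
  split_ifs <;> rfl

lemma swapIndex_val (hn : 3 ≤ n) (i : Fin (2 * n + 1 + 1)) : (swapIndex hn i).val =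
    if i.val < 2 then i.val + 2 else if i.val < 4 then i.val - 2 else i.val := by
  unfold swapIndex
  split_ifs <;> rfl

lemma involutive_rotIndex : Involutive (rotIndex (n := n)) := fun i => by
  ext
  simp only [rotIndex_val]
  split_ifs <;> omega

lemma involutive_swapIndex (hn : 3 ≤ n) : Involutive (swapIndex hn) := fun i => by
  ext
  simp only [swapIndex_val]
  split_ifs <;> omega

lemma swapIndex_rotIndex (hn : 3 ≤ n) (i : Fin (2 * n + 1 + 1)) :
    swapIndex hn (rotIndex i) = rotIndex (swapIndex hn i) := by
  ext
  simp only [swapIndex_val, rotIndex_val]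
  split_ifs <;> omega

/-- The signs of the complex structure `(x, y) ↦ (-y, x)` in each complex coordinate. -/
def rotSign (i : Fin (2 * n + 1 + 1)) : ℝ := if i.val % 2 = 0 then -1 else 1

/-- The coefficients of the map `(z₁, z₂, …) ↦ (-z̄₂, z̄₁, 0, …)`. -/
def swapSign (i : Fin (2 * n + 1 + 1)) : ℝ :=
  if i.val = 0 then -1 else if i.val < 3 then 1 else if i.val = 3 then -1 else 0

/-- The indicator function of the real and imaginary parts of the `k`-th complex coordinate,
counted from `0`. -/
def lineIndicator (k : ℕ) (i : Fin (2 * n + 1 + 1)) : ℝ := if i.val / 2 = k then 1 else 0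

lemma rotSign_rotIndex (i : Fin (2 * n + 1 + 1)) : rotSign (rotIndex i) = -1 * rotSign i := by
  simp only [rotSign, rotIndex_val]
  split_ifs <;> first | omega | contradiction | norm_num

lemma rotSign_swapIndex (hn : 3 ≤ n) (i : Fin (2 * n + 1 + 1)) :
    rotSign (swapIndex hn i) = rotSign i := by
  simp only [rotSign, swapIndex_val]
  split_ifs <;> first | omega | contradiction | norm_num

lemma swapSign_swapIndex (hn : 3 ≤ n) (i : Fin (2 * n + 1 + 1)) :
    swapSign (swapIndex hn i) = -1 * swapSign i := by
  simp only [swapSign, swapIndex_val]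
  split_ifs <;> first | omega | contradiction | norm_num

lemma swapSign_rotIndex (i : Fin (2 * n + 1 + 1)) : swapSign (rotIndex i) = -swapSign i := by
  simp only [swapSign, rotIndex_val]
  split_ifs <;> first | omega | contradiction | norm_num

lemma rotSign_mul_self (i : Fin (2 * n + 1 + 1)) : rotSign i * rotSign i = 1 := by
  unfold rotSign
  split_ifs <;> norm_num

lemma lineIndicator_rotIndex (k : ℕ) (i : Fin (2 * n + 1 + 1)) :
    lineIndicator k (rotIndex i) = lineIndicator k i := by
  simp only [lineIndicator, rotIndex_val]
  split_ifs <;> first | omega | rfl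

lemma lineIndicator_mul_self (k : ℕ) (i : Fin (2 * n + 1 + 1)) :
    lineIndicator k i * lineIndicator k i = lineIndicator k i := by
  unfold lineIndicator
  split_ifs <;> norm_num

lemma lineIndicator_mul_of_ne {k l : ℕ} (h : k ≠ l) (i : Fin (2 * n + 1 + 1)) :
    lineIndicator k i * lineIndicator l i = 0 := by
  unfold lineIndicator
  split_ifs <;> first | omega | contradiction | norm_num

lemma lineIndicator_mul_swapSign {k : ℕ} (h : 2 ≤ k) (i : Fin (2 * n + 1 + 1)) :
    lineIndicator k i * swapSign i = 0 := by
  unfold lineIndicator swapSign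
  split_ifs <;> first | omega | contradiction | norm_num

lemma swapSign_mul_lineIndicator (hn : 3 ≤ n) {k : ℕ} (h : 2 ≤ k) (i : Fin (2 * n + 1 + 1)) :
    swapSign i * lineIndicator k (swapIndex hn i) = 0 := by
  simp only [lineIndicator, swapSign, swapIndex_val]
  split_ifs <;> first | omega | contradiction | norm_num

/-- The projection to the `k`-th complex coordinate line, counted from `0`. -/
def lineProj (n k : ℕ) : Ambient (2 * n + 1) →L[ℝ] Ambient (2 * n + 1) :=
  weightedPerm id (lineIndicator k)

lemma lineProj_apply (k : ℕ) (x : Ambient (2 * n + 1)) (i : Fin (2 * n + 1 + 1)) :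
    lineProj n k x i = lineIndicator k i * x i := rfl

lemma lineProj_symm (k : ℕ) (x y : Ambient (2 * n + 1)) :
    ⟪lineProj n k x, y⟫_ℝ = ⟪x, lineProj n k y⟫_ℝ := by
  rw [lineProj, inner_weightedPerm (σ := id) (c := 1) (fun _ => rfl) (fun i => (one_mul _).symm),
    one_mul]

lemma lineProj_lineProj_self (k : ℕ) (x : Ambient (2 * n + 1)) :
    lineProj n k (lineProj n k x) = lineProj n k x := by
  ext i
  rw [lineProj_apply, lineProj_apply, ← mul_assoc, lineIndicator_mul_self]

lemma lineProj_lineProj_of_ne {k l : ℕ} (h : k ≠ l) (x : Ambient (2 * n + 1)) :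
    lineProj n k (lineProj n l x) = 0 := by
  ext i
  rw [lineProj_apply, lineProj_apply, ← mul_assoc, lineIndicator_mul_of_ne h, zero_mul]
  rfl

lemma lineProj_rot (k : ℕ) (x : Ambient (2 * n + 1)) :
    lineProj n k (weightedPerm rotIndex rotSign x) =
      weightedPerm rotIndex rotSign (lineProj n k x) := by
  ext i
  rw [lineProj_apply, weightedPerm_apply, weightedPerm_apply, lineProj_apply,
    lineIndicator_rotIndex, mul_left_comm]

lemma lineProj_swap (hn : 3 ≤ n) {k : ℕ} (h : 2 ≤ k) (x : Ambient (2 * n + 1)) :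
    lineProj n k (weightedPerm (swapIndex hn) swapSign x) = 0 := by
  ext i
  rw [lineProj_apply, weightedPerm_apply, ← mul_assoc, lineIndicator_mul_swapSign h, zero_mul]
  rfl

lemma swap_lineProj (hn : 3 ≤ n) {k : ℕ} (h : 2 ≤ k) (x : Ambient (2 * n + 1)) :
    weightedPerm (swapIndex hn) swapSign (lineProj n k x) = 0 := by
  ext i
  rw [weightedPerm_apply, lineProj_apply, ← mul_assoc, swapSign_mul_lineIndicator hn h, zero_mul]
  rfl

/-- The model on `ℂⁿ⁺¹`, with `A (z₁, z₂, z₃, …) = (-z̄₂, z̄₁, 0, …)`, and the projections to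
the third and the fourth coordinate lines. -/
def standardModel (hn : 3 ≤ n) : HermitianModel (Ambient (2 * n + 1)) where
  J := weightedPerm rotIndex rotSign
  A := weightedPerm (swapIndex hn) swapSign
  Q₁ := lineProj n 2
  Q₂ := lineProj n 3
  J_skew x y := by
    rw [inner_weightedPerm involutive_rotIndex rotSign_rotIndex, neg_one_mul]
  J_J x := by
    ext i
    rw [weightedPerm_apply, weightedPerm_apply, rotSign_rotIndex, involutive_rotIndex i]
    change _ = -x i
    linear_combination (-x i) * rotSign_mul_self i
  A_skew x y := by
    rw [inner_weightedPerm (involutive_swapIndex hn) (swapSign_swapIndex hn), neg_one_mul]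
  A_J x := by
    ext i
    change _ = -(weightedPerm rotIndex rotSign _ i)
    simp only [weightedPerm_apply]
    rw [rotSign_swapIndex, swapSign_rotIndex, swapIndex_rotIndex]
    ring
  Q₁_symm := lineProj_symm 2
  Q₂_symm := lineProj_symm 3
  Q₁_Q₁ := lineProj_lineProj_self 2
  Q₂_Q₂ := lineProj_lineProj_self 3
  Q₁_Q₂ := lineProj_lineProj_of_ne (by norm_num)
  Q₂_Q₁ := lineProj_lineProj_of_ne (by norm_num)
  Q₁_J := lineProj_rot 2
  Q₂_J := lineProj_rot 3
  Q₁_A := lineProj_swap hn (by norm_num)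
  Q₂_A := lineProj_swap hn (by norm_num)
  A_Q₁ := swap_lineProj hn (by norm_num)
  A_Q₂ := swap_lineProj hn (by norm_num)

/-- The unit vector of the real part of the `k`-th complex coordinate, counted from `0`. -/
def unitVec {k : ℕ} (hk : k ≤ n) : Ambient (2 * n + 1) :=
  EuclideanSpace.single ⟨2 * k, by omega⟩ 1

lemma norm_unitVec {k : ℕ} (hk : k ≤ n) : ‖unitVec hk‖ = 1 := by
  simp [unitVec]

lemma inner_unitVec {k l : ℕ} (hk : k ≤ n) (hl : l ≤ n) :
    ⟪unitVec hk, unitVec hl⟫_ℝ = if k = l then 1 else 0 := by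
  simp [unitVec, EuclideanSpace.inner_single_left, Fin.ext_iff]

lemma lineProj_unitVec (l : ℕ) {k : ℕ} (hk : k ≤ n) :
    lineProj n l (unitVec hk) = if k = l then unitVec hk else 0 := by
  ext i
  rw [lineProj_apply]
  by_cases hi : i = ⟨2 * k, by omega⟩
  · subst hi
    by_cases hkl : k = l <;> simp [lineIndicator, unitVec, hkl]
  · have h0 : unitVec hk i = 0 := by simp [unitVec, hi]
    rw [h0, mul_zero]
    split_ifs
    · exact h0.symm
    · rfl

lemma standardModel_A_unitVec_two (hn : 3 ≤ n) :
    (standardModel hn).A (unitVec (k := 2) (by omega)) = 0 := by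
  have h := (standardModel hn).A_Q₁ (unitVec (k := 2) (by omega))
  rwa [show (standardModel hn).Q₁ = lineProj n 2 from rfl, lineProj_unitVec, if_pos rfl] at h

lemma standardModel_A_unitVec_zero (hn : 3 ≤ n) :
    (standardModel hn).A (unitVec (k := 0) (by omega)) ≠ 0 := by
  intro h
  have h1 := congrArg (fun v : Ambient (2 * n + 1) => v ⟨2, by omega⟩) h
  change swapSign _ * unitVec (k := 0) _ (swapIndex hn ⟨2, by omega⟩) = (0 : ℝ) at h1
  have h2 : swapIndex hn ⟨2, by omega⟩ = ⟨2 * 0, by omega⟩ := by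
    ext
    rw [swapIndex_val]
    norm_num
  rw [h2] at h1
  simp [swapSign, unitVec] at h1

/-- A unit vector at which the deformed structure is not Sasakian: `m` does not vanish at it, and it
does not lie in the sum of the coordinate lines which define `m`. -/
def genericVec (hn : 3 ≤ n) : Ambient (2 * n + 1) :=
  (2 / 3 : ℝ) • unitVec (k := 0) (by omega) + (2 / 3 : ℝ) • unitVec (k := 2) (by omega)
    + (1 / 3 : ℝ) • unitVec (k := 3) hn

lemma norm_genericVec (hn : 3 ≤ n) : ‖genericVec hn‖ = 1 := by
  have h : ⟪genericVec hn, genericVec hn⟫_ℝ = 1 := by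
    simp only [genericVec, inner_add_left, inner_add_right, real_inner_smul_left,
      real_inner_smul_right, inner_unitVec]
    norm_num
  rw [real_inner_self_eq_norm_sq] at h
  exact (pow_eq_one_iff_of_nonneg (norm_nonneg _) two_ne_zero).1 h

lemma standardModel_a_genericVec (hn : 3 ≤ n) :
    (standardModel hn).a (genericVec hn) = 4 / 9 := by
  change ⟪genericVec hn, lineProj n 2 (genericVec hn)⟫_ℝ = _
  simp only [genericVec, map_add, map_smul, lineProj_unitVec, inner_add_left, inner_add_right,
    real_inner_smul_left, real_inner_smul_right]
  norm_num [norm_unitVec, inner_unitVec]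

lemma standardModel_b_genericVec (hn : 3 ≤ n) :
    (standardModel hn).b (genericVec hn) = 1 / 9 := by
  change ⟪genericVec hn, lineProj n 3 (genericVec hn)⟫_ℝ = _
  simp only [genericVec, map_add, map_smul, lineProj_unitVec, inner_add_left, inner_add_right,
    real_inner_smul_left, real_inner_smul_right]
  norm_num [norm_unitVec, inner_unitVec]

lemma standardModel_μ_genericVec (hn : 3 ≤ n) : (standardModel hn).μ (genericVec hn) ≠ 0 := by
  rw [HermitianModel.μ_eq, standardModel_a_genericVec, standardModel_b_genericVec]
  norm_num

lemma standardModel_s_genericVec (hn : 3 ≤ n) : (standardModel hn).s (genericVec hn) ≠ 1 := by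
  rw [HermitianModel.s, standardModel_a_genericVec, standardModel_b_genericVec]
  norm_num

end StandardModel

end KContactGeometry

end

theorem proposition4p3 (n : ℕ) (hn : 3 ≤ n) :
    ∃ (g : ℝ → RiemMetric (𝓡 (2 * n + 1)) (Sphere (2 * n + 1)))
      (ξ : VField (𝓡 (2 * n + 1)) (Sphere (2 * n + 1))),
      IsRoundDeformation g ∧
      ∀ t : ℝ, t ≠ 0 →
        IsKContact (g t) ξ ∧ ¬ IsSasakian (g t) ξ ∧
        ∃ A ∈ killingComponent (g t) ξ 2, ¬ HasConstantLength (g t) A := by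
  let S := standardModel hn
  let p : Sphere (2 * n + 1) := ⟨genericVec hn, mem_sphere_zero_iff_norm.2 (norm_genericVec hn)⟩
  let q₀ : Sphere (2 * n + 1) :=
    ⟨unitVec (k := 0) (by omega), mem_sphere_zero_iff_norm.2 (norm_unitVec _)⟩
  let q₂ : Sphere (2 * n + 1) :=
    ⟨unitVec (k := 2) (by omega), mem_sphere_zero_iff_norm.2 (norm_unitVec _)⟩
  refine ⟨S.metric, S.reeb, ⟨S.isSmoothFamily_metric, S.isRound_metric_zero⟩, fun t ht =>
    ⟨S.isKContact_reeb t, ?_, sphereField S.A, S.A_mem_killingComponent t, ?_⟩⟩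
  · exact S.not_isSasakian_reeb ht (x := p) (standardModel_μ_genericVec hn)
      (standardModel_s_genericVec hn)
  · exact S.not_hasConstantLength_A t (x := q₂) (y := q₀) (standardModel_A_unitVec_two hn)
      (standardModel_A_unitVec_zero hn)
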